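/- For a field $\mathbb K$ and a finite simple graph $G$ let $\mathrm{cl}(G)$ be the clique complex of $G$ (the simplicial complex whose faces are the cliques of $G$, including the empty one), and let $\tilde H_i(\mathrm{cl}(G);\mathbb K)$ denote its reduced simplicial homology. Let $$b_{C_4}(n)=b_{C_4}(n,\mathbb K)=\max_G\ \sum_{i\ge -1}\dim_{\mathbb K}\tilde H_i(\mathrm{cl}(G);\mathbb K),$$ where $G$ runs over all simple graphs on at most $n$ vertices that contain no induced copy of the $4$-cycle $C_4=K_{2,2}$. **Theorem.** There are constants $c,C>0$ such that for every field $\mathbb K$ $$c\,n^{3/2}<b_{C_4}(n,\mathbb K)\quad\text{for every integer } n\ge 0,\qquad b_{C_4}(n,\mathbb K)<n^{C\sqrt{\log n}}\quad\text{for every integer } n\ge 2 .$$ -/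

import Mathlib

noncomputable section

namespace CliqueBetti

/-- The simplicial boundary operator on `K`-linear combinations of subsets of a finite linearly
ordered vertex set `V`; the combination `∑ f(s) s` is written as its coefficient function
`f : Finset V → K`. It is the linear map with
`∂ s = ∑_{v ∈ s} (-1)^{#{w ∈ s : w < v}} (s \ {v})`, so the coefficient of `t` in `∂ f` collects
the sets `s = insert v t` with `v ∉ t`. It sends a singleton to the empty set (augmentation) and
the empty set to `0`; see `boundary_single`. -/
def boundary (K : Type*) [Field K] (V : Type*) [LinearOrder V] [Fintype V] :
    (Finset V → K) →ₗ[K] (Finset V → K) where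
  toFun f t := ∑ v ∈ tᶜ, (-1 : K) ^ (t.filter (· < v)).card * f (insert v t)
  map_add' f g := by
    funext t
    simp [mul_add, Finset.sum_add_distrib]
  map_smul' a f := by
    funext t
    simp only [Pi.smul_apply, smul_eq_mul, RingHom.id_apply, Finset.mul_sum]
    exact Finset.sum_congr rfl fun v _ => by ring

/-- The usual formula for the boundary of a single face. -/
theorem boundary_single (K : Type*) [Field K] (V : Type*) [LinearOrder V] [Fintype V]
    (s : Finset V) :
    boundary K V (Pi.single s 1) =
      ∑ v ∈ s, (-1 : K) ^ (s.filter (· < v)).card • Pi.single (s.erase v) (1 : K) := by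
  funext t
  simp only [boundary, LinearMap.coe_mk, AddHom.coe_mk, Finset.sum_apply, Pi.smul_apply,
    smul_eq_mul, Pi.single_apply, mul_ite, mul_one, mul_zero]
  rw [← Finset.sum_filter, ← Finset.sum_filter]
  refine Finset.sum_congr ?_ ?_
  · ext v
    simp only [Finset.mem_filter, Finset.mem_compl]
    constructor
    · rintro ⟨hv, rfl⟩
      exact ⟨Finset.mem_insert_self v t, (Finset.erase_insert hv).symm⟩
    · rintro ⟨hv, rfl⟩
      exact ⟨Finset.notMem_erase v s, Finset.insert_erase hv⟩
  · intro v hv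
    obtain ⟨hv, rfl⟩ := Finset.mem_filter.mp hv
    congr 2
    ext w
    simp only [Finset.mem_filter, Finset.mem_erase]
    constructor
    · rintro ⟨⟨_, h⟩, h'⟩
      exact ⟨h, h'⟩
    · rintro ⟨h, h'⟩
      exact ⟨⟨h'.ne, h⟩, h'⟩

variable (K : Type*) [Field K] {V : Type*} [LinearOrder V] [Fintype V] (G : SimpleGraph V)

/-- The augmented simplicial chains of the clique complex of `G` spanned by the faces with exactly
`k` vertices, that is, the reduced chains of degree `k - 1`. The faces of the clique complex are
the cliques of `G`, including the empty one. -/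
def chains (k : ℕ) : Submodule K (Finset V → K) where
  carrier := {f | ∀ s, f s ≠ 0 → G.IsNClique k s}
  zero_mem' := fun _ h => absurd rfl h
  add_mem' {f g} hf hg s h := by
    by_cases hs : f s = 0
    · exact hg s fun h' => h (by simp [hs, h'])
    · exact hf s hs
  smul_mem' a f hf s h := hf s fun h' => h (by simp [h'])

/-- The reduced cycles of degree `k - 1` of the clique complex of `G`. -/
def cycles (k : ℕ) : Submodule K (Finset V → K) :=
  chains K G k ⊓ LinearMap.ker (boundary K V)

/-- The reduced boundaries of degree `k - 1` of the clique complex of `G`. -/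
def boundaries (k : ℕ) : Submodule K (Finset V → K) :=
  (chains K G (k + 1)).map (boundary K V)

theorem boundary_boundary (f : Finset V → K) : boundary K V (boundary K V f) = 0 := by
  funext t
  simp only [boundary, LinearMap.coe_mk, AddHom.coe_mk, Finset.mul_sum, Pi.zero_apply]
  rw [Finset.sum_sigma']
  refine Finset.sum_involution (fun p _ => ⟨p.2, p.1⟩) ?_ ?_ ?_ ?_
  · rintro ⟨v, w⟩ h
    simp only [Finset.mem_sigma, Finset.mem_compl, Finset.mem_insert, not_or] at h
    obtain ⟨hv, hwv, hw⟩ := h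
    simp only [Finset.filter_insert, Finset.insert_comm w v t]
    rcases lt_or_gt_of_ne hwv with h | h
    · have hv' : v ∉ t.filter (· < w) := fun h' => hv (Finset.mem_filter.mp h').1
      have hw' : w ∉ t.filter (· < v) := fun h' => hw (Finset.mem_filter.mp h').1
      rw [if_neg h.le.not_gt, if_pos h, Finset.card_insert_of_notMem hw', pow_succ]
      ring
    · have hv' : v ∉ t.filter (· < w) := fun h' => hv (Finset.mem_filter.mp h').1
      rw [if_pos h, if_neg h.le.not_gt, Finset.card_insert_of_notMem hv', pow_succ]
      ring
  · rintro ⟨v, w⟩ h _ h'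
    simp only [Finset.mem_sigma, Finset.mem_compl, Finset.mem_insert, not_or] at h
    simp only [Sigma.mk.injEq, heq_eq_eq] at h'
    exact h.2.1 h'.1
  · rintro ⟨v, w⟩ h
    simp only [Finset.mem_sigma, Finset.mem_compl, Finset.mem_insert, not_or] at h ⊢
    exact ⟨h.2.2, fun h' => h.2.1 h'.symm, h.1⟩
  · rintro ⟨v, w⟩ _
    rfl

/-- The augmented simplicial chains form a chain complex. -/
theorem boundaries_le_cycles (k : ℕ) : boundaries K G k ≤ cycles K G k := by
  rintro _ ⟨f, hf, rfl⟩
  refine ⟨fun t ht => ?_, boundary_boundary K f⟩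
  obtain ⟨v, hv, h⟩ := Finset.exists_ne_zero_of_sum_ne_zero ht
  have hv := Finset.mem_compl.mp hv
  have hc := hf (insert v t) (right_ne_zero_of_mul h)
  refine ⟨hc.isClique.subset (by simp), ?_⟩
  have := hc.card_eq
  rw [Finset.card_insert_of_notMem hv] at this
  omega

/-- The reduced simplicial homology of the clique complex of `G` with coefficients in `K`, in
degree `k - 1` (so `k = 0` is degree `-1`). -/
abbrev ReducedHomology (k : ℕ) :=
  cycles K G k ⧸ (boundaries K G k).submoduleOf (cycles K G k)

/-- The total reduced Betti number of the clique complex of a finite graph: the sum of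
`dim H̃_{k-1}` over all `k ≥ 0`. Terms with `k > |V|` vanish as there are no faces of that size. -/
def totalBetti : ℕ :=
  ∑ k ∈ Finset.range (Fintype.card V + 1), Module.finrank K (ReducedHomology K G k)

open Classical in
/-- `bMax K H n` is `b_H(n, K)`: the maximum of the total reduced Betti number of the clique
complex of `G`, over all simple graphs `G` on at most `n` vertices with no induced copy of `H`. -/
def bMax {W : Type*} (H : SimpleGraph W) (n : ℕ) : ℕ :=
  (Finset.range (n + 1)).sup fun m =>
    ((Finset.univ : Finset (SimpleGraph (Fin m))).filter fun G => ¬ H.IsIndContained G).sup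
      fun G => totalBetti K G

end CliqueBetti

end

/-! Upper bound. Write β(S) for the total reduced Betti number of the clique complex of G[S].
Mayer–Vietoris gives β(P ∪ Q) ≤ β(P) + β(Q) + β(P ∩ Q) when no edge joins P \ Q to Q \ P. Cones are
acyclic, so deleting a vertex costs at most β of its neighbourhood. In a graph without induced
4-cycles, adjacent vertices have nested closed neighbourhoods inside any clique. This makes every
complex dominated by a clique acyclic, and so a whole clique can be deleted at the price of β of its
outer neighbourhood (`inducedBetti_le_sdiff_add_outerNeighbors`).

The combinatorial heart is `NoInducedSquare.exists_clique_few_outerNeighbors`: a set U covered by r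
cliques contains a clique with at least |U|/(25r) vertices whose outer neighbourhood has at most
0.99|U| vertices. Hence O(r) clique deletions shrink U by the factor 0.99, and each such round
multiplies the bound on β by at most 1 + 30r.

Few cliques are available because large minimum degree forces a large clique. For a parameter t, an
n-vertex graph splits into O(t³) cliques and a remainder all of whose nonempty subsets induce a
vertex of degree below n/t. After O(log t) rounds the clique part has at most n/t vertices. The
remainder is then deleted vertex by vertex, each deletion costing β of a set of at most 2n/t
vertices. So the maximum β(n) satisfies β(n) ≤ t^{O(log t)} (n+1) β(2n/t). With t ≈ exp √(log n)
each level of this recursion costs a factor exp(O(log n)), and there are O(√(log n)) levels.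

Lower bound. The point-line incidence graph of an affine plane of order p (without vertical lines)
has 2p² vertices, p³ edges, no triangle and no 4-cycle, so its first Betti number is at least p³ −
2p². -/

open Module

namespace CliqueBetti

/-! ### Ungraded homology of a subspace stable under a differential -/

section HomologyDim

variable {K M : Type*} [Field K] [AddCommGroup M] [Module K M]

/-- The dimension of the homology of a subspace `P` stable under a differential `d`, as
`dim P - 2 rank (d|P)`. -/
noncomputable def homologyDim (d : M →ₗ[K] M) (P : Submodule K M) : ℤ :=
  finrank K P - 2 * finrank K (P.map d)

variable {d : M →ₗ[K] M}

theorem map_le_inf_ker (hd : ∀ x, d (d x) = 0) {P : Submodule K M} (hP : P.map d ≤ P) :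
    P.map d ≤ P ⊓ LinearMap.ker d := by
  refine le_inf hP ?_
  rintro _ ⟨x, -, rfl⟩
  exact hd x

variable [FiniteDimensional K M]

theorem finrank_map_add_finrank_inf_ker (d : M →ₗ[K] M) (P : Submodule K M) :
    finrank K (P.map d) + finrank K (P ⊓ LinearMap.ker d : Submodule K M) = finrank K P := by
  have h := LinearMap.finrank_range_add_finrank_ker (d.domRestrict P)
  have e : LinearMap.ker (d.domRestrict P) = (P ⊓ LinearMap.ker d).submoduleOf P := by
    ext x
    simp [Submodule.submoduleOf]
  rw [LinearMap.range_domRestrict, e,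
    (Submodule.submoduleOfEquivOfLe (inf_le_left : P ⊓ LinearMap.ker d ≤ P)).finrank_eq] at h
  exact h

theorem homologyDim_nonneg (hd : ∀ x, d (d x) = 0) {P : Submodule K M} (hP : P.map d ≤ P) :
    0 ≤ homologyDim d P := by
  have h₁ := finrank_map_add_finrank_inf_ker d P
  have h₂ := Submodule.finrank_mono (map_le_inf_ker hd hP)
  unfold homologyDim
  omega

theorem homologyDim_eq_zero {P : Submodule K M} (hP : P ⊓ LinearMap.ker d ≤ P.map d)
    (h0 : 0 ≤ homologyDim d P) : homologyDim d P = 0 := by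
  have h₁ := finrank_map_add_finrank_inf_ker d P
  have h₂ := Submodule.finrank_mono hP
  unfold homologyDim at *
  omega

/-- The inequality extracted from the Mayer–Vietoris sequence. -/
theorem homologyDim_sup_le (hd : ∀ x, d (d x) = 0) {P Q : Submodule K M} (hP : P.map d ≤ P)
    (hQ : Q.map d ≤ Q) :
    homologyDim d (P ⊔ Q) ≤ homologyDim d P + homologyDim d Q + homologyDim d (P ⊓ Q) := by
  have h₁ := Submodule.finrank_sup_add_finrank_inf_eq P Q
  have h₂ := Submodule.finrank_sup_add_finrank_inf_eq (P.map d) (Q.map d)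
  have h₃ := finrank_map_add_finrank_inf_ker d (P ⊓ Q)
  -- The only inequality in the count: an element of dP ∩ dQ is a cycle of P ∩ Q. All other terms
  -- are exact dimension formulas.
  have h₄ : P.map d ⊓ Q.map d ≤ (P ⊓ Q) ⊓ LinearMap.ker d :=
    le_inf (inf_le_inf hP hQ) (inf_le_left.trans ((map_le_inf_ker hd hP).trans inf_le_right))
  have h₅ := Submodule.finrank_mono h₄
  unfold homologyDim
  rw [Submodule.map_sup]
  omega

end HomologyDim

/-! ### Coordinate subspaces: set operations on faces become lattice operations -/

section SupportedOn

variable (K : Type*) [Field K] {ι : Type*}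

/-- The functions vanishing outside `Δ`. -/
def supportedOn (Δ : Set ι) : Submodule K (ι → K) where
  carrier := {f | ∀ s, f s ≠ 0 → s ∈ Δ}
  zero_mem' := fun _ h => absurd rfl h
  add_mem' {f g} hf hg s h := by
    by_cases hs : f s = 0
    · exact hg s fun h' => h (by simp [hs, h'])
    · exact hf s hs
  smul_mem' a f hf s h := hf s fun h' => h (by simp [h'])

variable {K}

theorem mem_supportedOn {Δ : Set ι} {f : ι → K} :
    f ∈ supportedOn K Δ ↔ ∀ s, f s ≠ 0 → s ∈ Δ := Iff.rfl

theorem supportedOn_mono {Δ Δ' : Set ι} (h : Δ ⊆ Δ') : supportedOn K Δ ≤ supportedOn K Δ' :=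
  fun _ hf s hs => h (hf s hs)

theorem supportedOn_inter (Δ Δ' : Set ι) :
    supportedOn K (Δ ∩ Δ') = supportedOn K Δ ⊓ supportedOn K Δ' := by
  ext f
  simp only [mem_supportedOn, Submodule.mem_inf, Set.mem_inter_iff]
  exact ⟨fun h => ⟨fun s hs => (h s hs).1, fun s hs => (h s hs).2⟩,
    fun h s hs => ⟨h.1 s hs, h.2 s hs⟩⟩

theorem supportedOn_union (Δ Δ' : Set ι) :
    supportedOn K (Δ ∪ Δ') = supportedOn K Δ ⊔ supportedOn K Δ' := by
  classical
  refine le_antisymm (fun f hf => ?_) (sup_le (supportedOn_mono Set.subset_union_left)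
    (supportedOn_mono Set.subset_union_right))
  refine Submodule.mem_sup.2 ⟨fun s => if s ∈ Δ then f s else 0, fun s hs => ?_,
    fun s => if s ∈ Δ then 0 else f s, fun s hs => ?_, ?_⟩
  · by_contra h
    simp [h] at hs
  · by_cases h : s ∈ Δ
    · simp [h] at hs
    · simp only [h, if_false] at hs
      exact (hf s hs).resolve_left h
  · funext s
    by_cases h : s ∈ Δ <;> simp [h]

theorem finrank_supportedOn [Finite ι] (Δ : Set ι) : finrank K (supportedOn K Δ) = Δ.ncard := by
  classical
  have := Fintype.ofFinite ι
  have e : supportedOn K Δ ≃ₗ[K] (Δ → K) :=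
    { toFun := fun f s => f.1 s
      map_add' := fun _ _ => rfl
      map_smul' := fun _ _ => rfl
      invFun := fun g => ⟨fun s => if h : s ∈ Δ then g ⟨s, h⟩ else 0, fun s hs => by
        by_contra h
        simp [h] at hs⟩
      left_inv := fun f => by
        ext s
        by_cases h : s ∈ Δ
        · simp [h]
        · simp only [h, dite_false]
          by_contra hne
          exact h (f.2 s (Ne.symm hne))
      right_inv := fun g => by
        funext s
        simp }
  rw [e.finrank_eq, finrank_fintype_fun_eq_card, ← Nat.card_eq_fintype_card,
    Nat.card_coe_set_eq]

end SupportedOn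

/-! ### Betti numbers of induced clique complexes: Mayer–Vietoris and cones -/

section Betti

/-- The faces of the clique complex of the subgraph of `G` induced by `S`. -/
def cliquesIn {V : Type*} (G : SimpleGraph V) (S : Finset V) : Set (Finset V) :=
  {s | s ⊆ S ∧ G.IsClique (s : Set V)}

theorem cliquesIn_down_closed {V : Type*} (G : SimpleGraph V) (S : Finset V) :
    ∀ s ∈ cliquesIn G S, ∀ t ⊆ s, t ∈ cliquesIn G S :=
  fun _ hs _ ht => ⟨ht.trans hs.1, hs.2.subset (by exact_mod_cast ht)⟩

variable (K : Type*) [Field K] {V : Type*} [LinearOrder V] [Fintype V] (G : SimpleGraph V)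

theorem map_boundary_supportedOn_le {Δ : Set (Finset V)}
    (hΔ : ∀ s ∈ Δ, ∀ t ⊆ s, t ∈ Δ) :
    (supportedOn K Δ).map (boundary K V) ≤ supportedOn K Δ := by
  rintro _ ⟨f, hf, rfl⟩ t ht
  obtain ⟨v, -, h⟩ := Finset.exists_ne_zero_of_sum_ne_zero ht
  exact hΔ _ (hf _ (right_ne_zero_of_mul h)) _ (Finset.subset_insert v t)

/-- The total reduced Betti number of the clique complex of the subgraph induced by `S`. -/
noncomputable def inducedBetti (S : Finset V) : ℤ :=
  homologyDim (boundary K V) (supportedOn K (cliquesIn G S))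

theorem inducedBetti_nonneg (S : Finset V) : 0 ≤ inducedBetti K G S :=
  homologyDim_nonneg (boundary_boundary K)
    (map_boundary_supportedOn_le K (cliquesIn_down_closed G S))

theorem inducedBetti_le_two_pow (S : Finset V) : inducedBetti K G S ≤ 2 ^ S.card := by
  have h : (cliquesIn G S).ncard ≤ 2 ^ S.card := by
    rw [← Finset.card_powerset, ← Set.ncard_coe_finset]
    exact Set.ncard_le_ncard (fun s hs => by simpa using hs.1)
  have h' : ((cliquesIn G S).ncard : ℤ) ≤ 2 ^ S.card := by exact_mod_cast h
  unfold inducedBetti homologyDim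
  rw [finrank_supportedOn]
  omega

variable {G}

/-- With no edge between P \ Q and Q \ P, every clique in the union lies in P or in Q, so the
complex is the union of the two subcomplexes and the ungraded Mayer–Vietoris inequality applies. -/
theorem inducedBetti_union_le {P Q : Finset V}
    (h : ∀ x ∈ P \ Q, ∀ y ∈ Q \ P, ¬ G.Adj x y) :
    inducedBetti K G (P ∪ Q) ≤
      inducedBetti K G P + inducedBetti K G Q + inducedBetti K G (P ∩ Q) := by
  have hU : cliquesIn G (P ∪ Q) = cliquesIn G P ∪ cliquesIn G Q := by
    ext s
    constructor
    · rintro ⟨hs, hc⟩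
      by_cases hP : s ⊆ P
      · exact Or.inl ⟨hP, hc⟩
      · refine Or.inr ⟨fun y hy => ?_, hc⟩
        obtain ⟨x, hx, hxP⟩ := Finset.not_subset.1 hP
        have hxQ : x ∈ Q := (Finset.mem_union.1 (hs hx)).resolve_left hxP
        by_contra hyQ
        have hyP : y ∈ P := (Finset.mem_union.1 (hs hy)).resolve_right hyQ
        have hne : y ≠ x := fun e => hxP (e ▸ hyP)
        exact h y (by simp [hyP, hyQ]) x (by simp [hxP, hxQ]) (hc hy hx hne)
    · rintro (hs | hs)
      · exact ⟨hs.1.trans Finset.subset_union_left, hs.2⟩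
      · exact ⟨hs.1.trans Finset.subset_union_right, hs.2⟩
  have hI : cliquesIn G (P ∩ Q) = cliquesIn G P ∩ cliquesIn G Q := by
    ext s
    simp only [cliquesIn, Set.mem_ofPred_eq, Set.mem_inter_iff, Finset.subset_inter_iff]
    tauto
  unfold inducedBetti
  rw [hU, hI, supportedOn_union, supportedOn_inter]
  exact homologyDim_sup_le (boundary_boundary K)
    (map_boundary_supportedOn_le K (cliquesIn_down_closed G P))
    (map_boundary_supportedOn_le K (cliquesIn_down_closed G Q))

/-- The clique complex of a cone is acyclic. -/
theorem inducedBetti_cone {S : Finset V} {a : V} (ha : a ∈ S)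
    (hS : ∀ x ∈ S, x ≠ a → G.Adj a x) : inducedBetti K G S = 0 := by
  refine homologyDim_eq_zero ?_ (inducedBetti_nonneg K G S)
  rintro f ⟨hf, hdf⟩
  have hdf : ∀ t, boundary K V f t = 0 := fun t => congrFun hdf t
  -- The filling of the cycle f is the cone a * f. On t not containing a only v = a contributes and
  -- returns f t; on t containing a the cycle equation at `t.erase a` turns the sum into f t.
  refine ⟨fun s => if a ∈ s then (-1 : K) ^ (s.filter (· < a)).card * f (s.erase a) else 0,
    fun s hs => ?_, ?_⟩
  · have has : a ∈ s := by
      by_contra h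
      simp [h] at hs
    simp only [has, if_true] at hs
    obtain ⟨h₁, h₂⟩ := hf _ (right_ne_zero_of_mul hs)
    have hsS : s ⊆ S := fun x hx => by
      by_cases hxa : x = a
      · exact hxa ▸ ha
      · exact h₁ (Finset.mem_erase.2 ⟨hxa, hx⟩)
    refine ⟨hsS, ?_⟩
    rw [← Finset.insert_erase has, Finset.coe_insert]
    exact h₂.insert fun b hb hab => hS b (h₁ hb) hab.symm
  · funext t
    simp only [boundary, LinearMap.coe_mk, AddHom.coe_mk]
    by_cases hat : a ∈ t
    · have key := hdf (t.erase a)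
      simp only [boundary, LinearMap.coe_mk, AddHom.coe_mk] at key
      have hc : (t.erase a)ᶜ = insert a tᶜ := by
        ext x
        simp only [Finset.mem_compl, Finset.mem_erase, Finset.mem_insert]
        tauto
      rw [hc, Finset.sum_insert (by simpa using hat), Finset.insert_erase hat] at key
      have hsq : ∀ n : ℕ, (-1 : K) ^ n * (-1 : K) ^ n = 1 := fun n => by
        rw [← mul_pow]; simp
      have hterm : ∀ v ∈ tᶜ, ((-1 : K) ^ (t.filter (· < v)).card *
          if a ∈ insert v t then (-1 : K) ^ ((insert v t).filter (· < a)).card *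
            f ((insert v t).erase a) else 0) =
          -((-1 : K) ^ ((t.erase a).filter (· < a)).card *
            ((-1 : K) ^ ((t.erase a).filter (· < v)).card * f (insert v (t.erase a)))) := by
        intro v hv
        have hvt : v ∉ t := Finset.mem_compl.1 hv
        have hva : v ≠ a := fun h => hvt (h ▸ hat)
        rw [if_pos (Finset.mem_insert_of_mem hat), Finset.erase_insert_of_ne hva]
        have h₁ : (t.erase a).filter (· < a) = t.filter (· < a) := by
          ext x
          simp only [Finset.mem_filter, Finset.mem_erase]
          exact ⟨fun h => ⟨h.1.2, h.2⟩, fun h => ⟨⟨h.2.ne, h.1⟩, h.2⟩⟩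
        rw [h₁, Finset.filter_insert, Finset.filter_erase]
        rcases lt_or_gt_of_ne hva with h | h
        · rw [if_pos h, Finset.card_insert_of_notMem (by simp [hvt]),
            Finset.erase_eq_of_notMem (s := t.filter (· < v)) (a := a) (by simp [h.le])]
          ring
        · rw [if_neg h.le.not_gt,
            ← Finset.card_erase_add_one (s := t.filter (· < v)) (a := a) (by simp [hat, h])]
          ring
      rw [Finset.sum_congr rfl hterm, Finset.sum_neg_distrib, ← Finset.mul_sum,
        eq_neg_of_add_eq_zero_right key, mul_neg, neg_neg, ← mul_assoc, hsq, one_mul]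
    · rw [Finset.sum_eq_single a]
      · rw [if_pos (Finset.mem_insert_self a t), Finset.erase_insert hat, Finset.filter_insert,
          if_neg (lt_irrefl a), ← mul_assoc, ← mul_pow]
        simp
      · intro v hv hva
        rw [if_neg (by simp [hat, Ne.symm hva]), mul_zero]
      · intro h
        exact absurd (Finset.mem_compl.2 hat) h

end Betti

/-! ### Local structure of graphs without induced 4-cycles -/

section NoSquare

variable {V : Type*} {G : SimpleGraph V}

/-- Every 4-cycle of `G` has a chord. -/
def NoInducedSquare (G : SimpleGraph V) : Prop :=
  ∀ ⦃a b c d⦄, G.Adj a b → G.Adj b c → G.Adj c d → G.Adj d a → a ≠ c → b ≠ d →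
    G.Adj a c ∨ G.Adj b d

theorem noInducedSquare_of_not_isIndContained
    (h : ¬ (SimpleGraph.cycleGraph 4).IsIndContained G) : NoInducedSquare G := by
  intro a b c d hab hbc hcd hda hac hbd
  by_contra! hn
  obtain ⟨hn₁, hn₂⟩ := hn
  refine h ⟨⟨⟨![a, b, c, d], ?_⟩, ?_⟩⟩
  · intro i j hij
    fin_cases i <;> fin_cases j <;>
      simp_all [hab.ne, hbc.ne, hcd.ne, hda.ne, hab.ne', hbc.ne', hcd.ne', hda.ne', hac.symm,
        hbd.symm]
  · intro i j
    change G.Adj (![a, b, c, d] i) (![a, b, c, d] j) ↔ _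
    fin_cases i <;> fin_cases j <;>
      first
      | exact iff_of_false G.irrefl (by decide)
      | exact iff_of_true hab (by decide)
      | exact iff_of_true hab.symm (by decide)
      | exact iff_of_true hbc (by decide)
      | exact iff_of_true hbc.symm (by decide)
      | exact iff_of_true hcd (by decide)
      | exact iff_of_true hcd.symm (by decide)
      | exact iff_of_true hda (by decide)
      | exact iff_of_true hda.symm (by decide)
      | exact iff_of_false hn₁ (by decide)
      | exact iff_of_false hn₂ (by decide)
      | exact iff_of_false (fun h => hn₁ h.symm) (by decide)
      | exact iff_of_false (fun h => hn₂ h.symm) (by decide)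

/-- The closed neighbourhood relation. -/
def EqOrAdj (G : SimpleGraph V) (x y : V) : Prop := x = y ∨ G.Adj x y

theorem EqOrAdj.symm {x y : V} (h : EqOrAdj G x y) : EqOrAdj G y x :=
  h.imp Eq.symm SimpleGraph.Adj.symm

/-- In a graph without induced 4-cycles, two adjacent vertices have nested closed neighbourhoods
in every clique. -/
theorem NoInducedSquare.nested (hG : NoInducedSquare G) {A : Finset V}
    (hA : G.IsClique (A : Set V)) {x y : V} (hxy : EqOrAdj G x y) :
    (∀ a ∈ A, EqOrAdj G x a → EqOrAdj G y a) ∨ (∀ a ∈ A, EqOrAdj G y a → EqOrAdj G x a) := by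
  by_contra! hn
  obtain ⟨⟨a, ha, hxa, hya⟩, b, hb, hyb, hxb⟩ := hn
  have hxy' : G.Adj x y := hxy.resolve_left fun e => hya (e ▸ hxa)
  have hxa' : G.Adj x a := hxa.resolve_left fun e => hya (Or.inr (e ▸ hxy'.symm))
  have hyb' : G.Adj y b := hyb.resolve_left fun e => hxb (Or.inr (e ▸ hxy'))
  have hab : a ≠ b := fun e => hya (e ▸ hyb)
  rcases hG hxa' (hA ha hb hab) hyb'.symm hxy'.symm (fun e => hxb (Or.inl e))
    (fun e => hya (Or.inl e.symm)) with h | h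
  · exact hxb (Or.inr h)
  · exact hya (Or.inr h.symm)

/-- Common neighbours of two distinct non-adjacent vertices form a clique. -/
theorem NoInducedSquare.isClique_common (hG : NoInducedSquare G) {x y : V} (hne : x ≠ y)
    (hxy : ¬ G.Adj x y) {A : Finset V} (hA : ∀ a ∈ A, G.Adj x a ∧ G.Adj y a) :
    G.IsClique (A : Set V) := fun a ha b hb hab =>
  (hG (hA a ha).1 (hA a ha).2.symm (hA b hb).2 (hA b hb).1.symm hne hab).resolve_left hxy

variable [DecidableEq V] [DecidableRel G.Adj]

variable (G) in
/-- The vertices of `S` outside `A` with a neighbour in `A`. -/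
def outerNeighbors (A S : Finset V) : Finset V := S.filter fun x => x ∉ A ∧ ∃ a ∈ A, G.Adj a x

theorem mem_outerNeighbors {A S : Finset V} {x : V} :
    x ∈ outerNeighbors G A S ↔ x ∈ S ∧ x ∉ A ∧ ∃ a ∈ A, G.Adj a x := by
  simp [outerNeighbors]

end NoSquare

/-! ### Deleting a vertex or a clique -/

section Betti

variable (K : Type*) [Field K] {V : Type*} [LinearOrder V] [Fintype V] {G : SimpleGraph V}
  [DecidableRel G.Adj]

/-- The star of x is a cone, hence acyclic, and it meets the complex on S \ {x} in the link of x,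
which is the clique complex of the neighbourhood. -/
theorem inducedBetti_le_erase_add_neighbors {S : Finset V} {x : V} (hx : x ∈ S) :
    inducedBetti K G S ≤
      inducedBetti K G (S.erase x) + inducedBetti K G (S.filter (G.Adj x)) := by
  have h := inducedBetti_union_le K (G := G) (P := S.erase x) (Q := insert x (S.filter (G.Adj x)))
    (by
      intro y hy z hz hyz
      simp only [Finset.mem_sdiff, Finset.mem_erase, Finset.mem_insert, Finset.mem_filter] at hy hz
      have hzx : z = x := by tauto
      subst hzx
      exact hy.2 (Or.inr ⟨hy.1.2, hyz.symm⟩))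
  have hU : S.erase x ∪ insert x (S.filter (G.Adj x)) = S := by
    ext y
    simp only [Finset.mem_union, Finset.mem_erase, Finset.mem_insert, Finset.mem_filter]
    by_cases hy : y = x <;> simp_all
  have hI : S.erase x ∩ insert x (S.filter (G.Adj x)) = S.filter (G.Adj x) := by
    ext y
    simp only [Finset.mem_inter, Finset.mem_erase, Finset.mem_insert, Finset.mem_filter]
    by_cases hy : y = x <;> simp_all
  rw [hU, hI, inducedBetti_cone K (Finset.mem_insert_self x _)
    (fun y hy hyx => (Finset.mem_filter.1 ((Finset.mem_insert.1 hy).resolve_left hyx)).2)] at h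
  omega

/-- If every vertex has a closed neighbour in the nonempty clique `A`, then the clique complex is
acyclic. -/
theorem inducedBetti_eq_zero_of_dominating_clique (hG : NoInducedSquare G) (n : ℕ) :
    ∀ {S A : Finset V}, S.card = n → A ⊆ S → A.Nonempty → G.IsClique (A : Set V) →
      (∀ x ∈ S, ∃ a ∈ A, EqOrAdj G x a) → inducedBetti K G S = 0 := by
  induction n using Nat.strong_induction_on with
  | _ n ih =>
    intro S A hn hAS hA hc hdom
    by_cases hS : S ⊆ A
    · obtain ⟨a, ha⟩ := hA
      exact inducedBetti_cone K (hAS ha) fun x hx hxa => hc ha (hS hx) hxa.symm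
    · obtain ⟨x, hx, hxA⟩ := Finset.not_subset.1 hS
      have h₁ : inducedBetti K G (S.erase x) = 0 :=
        ih _ (hn ▸ Finset.card_erase_lt_of_mem hx) rfl (Finset.subset_erase.2 ⟨hAS, hxA⟩) hA hc
          fun y hy => hdom y (Finset.mem_of_mem_erase hy)
      have hlt : (S.filter (G.Adj x)).card < n := by
        rw [← hn]
        exact Finset.card_lt_card (Finset.filter_ssubset.2 ⟨x, hx, G.irrefl⟩)
      have h₂ : inducedBetti K G (S.filter (G.Adj x)) = 0 := by
        refine ih _ hlt rfl (A := A.filter (G.Adj x)) (Finset.filter_subset_filter _ hAS) ?_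
          (hc.subset (by exact_mod_cast Finset.filter_subset _ A)) ?_
        · obtain ⟨a, ha, hxa⟩ := hdom x hx
          exact ⟨a, Finset.mem_filter.2 ⟨ha, hxa.resolve_left fun e => hxA (e ▸ ha)⟩⟩
        · intro y hy
          obtain ⟨hyS, hxy⟩ := Finset.mem_filter.1 hy
          obtain ⟨a, ha, hxa⟩ := hdom x hx
          obtain ⟨b, hb, hyb⟩ := hdom y hyS
          -- The neighbourhood of x is dominated by A ∩ N(x). Nestedness supplies a dominator of y
          -- there: either x's own neighbour a also dominates y, or y's dominator b is a neighbour
          -- of x.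
          rcases hG.nested hc (Or.inr hxy) with h | h
          · exact ⟨a, Finset.mem_filter.2 ⟨ha, hxa.resolve_left fun e => hxA (e ▸ ha)⟩, h a ha hxa⟩
          · exact ⟨b, Finset.mem_filter.2
              ⟨hb, (h b hb hyb).resolve_left fun e => hxA (e ▸ hb)⟩, hyb⟩
      have h₃ := inducedBetti_le_erase_add_neighbors K (G := G) hx
      have h₄ := inducedBetti_nonneg K G S
      omega

/-- Removing a clique `A` costs at most the Betti number of its outer neighbourhood. -/
theorem inducedBetti_le_sdiff_add_outerNeighbors (hG : NoInducedSquare G) {S A : Finset V}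
    (hAS : A ⊆ S) (hA : A.Nonempty) (hc : G.IsClique (A : Set V)) :
    inducedBetti K G S ≤
      inducedBetti K G (S \ A) + inducedBetti K G (outerNeighbors G A S) := by
  -- The second piece is dominated by A and therefore acyclic; its overlap with S \ A is exactly the
  -- outer neighbourhood.
  have h := inducedBetti_union_le K (G := G) (P := S \ A) (Q := A ∪ outerNeighbors G A S)
    (by
      intro y hy z hz hyz
      simp only [Finset.mem_sdiff, Finset.mem_union, mem_outerNeighbors] at hy hz
      have hzA : z ∈ A := by tauto
      exact hy.2 (Or.inr ⟨hy.1.1, hy.1.2, z, hzA, hyz.symm⟩))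
  have hU : S \ A ∪ (A ∪ outerNeighbors G A S) = S := by
    ext y
    simp only [Finset.mem_sdiff, Finset.mem_union, mem_outerNeighbors]
    by_cases hy : y ∈ A
    · simp [hy, hAS hy]
    · simp only [hy]
      tauto
  have hI : (S \ A) ∩ (A ∪ outerNeighbors G A S) = outerNeighbors G A S := by
    ext y
    simp only [Finset.mem_inter, Finset.mem_sdiff, Finset.mem_union, mem_outerNeighbors]
    tauto
  have h0 : inducedBetti K G (A ∪ outerNeighbors G A S) = 0 := by
    refine inducedBetti_eq_zero_of_dominating_clique K hG _ rfl Finset.subset_union_left hA hc ?_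
    intro x hx
    rcases Finset.mem_union.1 hx with hx | hx
    · exact ⟨x, hx, Or.inl rfl⟩
    · obtain ⟨-, -, a, ha, hax⟩ := mem_outerNeighbors.1 hx
      exact ⟨a, ha, Or.inr hax.symm⟩
  rw [hU, hI, h0] at h
  omega

end Betti

/-! ### A large clique with a small outer neighbourhood -/

section CliqueCover

variable {V : Type*} [DecidableEq V] {G : SimpleGraph V}

/-- Pigeonhole: take the member of the cover meeting W most. -/
theorem exists_clique_of_cover {F : Finset (Finset V)} (hF : ∀ A ∈ F, G.IsClique (A : Set V))
    {W : Finset V} (hW : W ⊆ F.biUnion id) :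
    ∃ D ⊆ W, G.IsClique (D : Set V) ∧ W.card ≤ F.card * D.card := by
  rcases F.eq_empty_or_nonempty with rfl | hne
  · exact ⟨∅, by simp, by simp, by simpa using hW⟩
  obtain ⟨A, hA, hmax⟩ := F.exists_max_image (fun A => (W ∩ A).card) hne
  refine ⟨W ∩ A, Finset.inter_subset_left,
    (hF A hA).subset (by exact_mod_cast Finset.inter_subset_right), ?_⟩
  have hsub : W ⊆ F.biUnion fun B => W ∩ B := fun x hx => by
    obtain ⟨B, hB, hxB⟩ := Finset.mem_biUnion.1 (hW hx)
    exact Finset.mem_biUnion.2 ⟨B, hB, Finset.mem_inter.2 ⟨hx, hxB⟩⟩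
  exact (Finset.card_le_card hsub).trans (Finset.card_biUnion_le_card_mul _ _ _ hmax)

variable [DecidableRel G.Adj]

instance : DecidableRel (EqOrAdj G) := fun x y => inferInstanceAs (Decidable (x = y ∨ G.Adj x y))

theorem card_outerNeighbors_add_card_le {A U : Finset V} (hA : A ⊆ U) :
    (outerNeighbors G A U).card + A.card ≤ U.card := by
  rw [← Finset.card_union_of_disjoint]
  · exact Finset.card_le_card (Finset.union_subset (Finset.filter_subset _ _) hA)
  · exact Finset.disjoint_left.2 fun x hx => (mem_outerNeighbors.1 hx).2.1

/-- In a graph without induced 4-cycles covered by few cliques, some large clique has an outer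
neighbourhood missing a positive proportion of the vertices. -/
theorem NoInducedSquare.exists_clique_few_outerNeighbors (hG : NoInducedSquare G)
    {F : Finset (Finset V)} (hF : ∀ A ∈ F, G.IsClique (A : Set V)) {U : Finset V}
    (hU : U ⊆ F.biUnion id) (hne : U.Nonempty) :
    ∃ A ⊆ U, G.IsClique (A : Set V) ∧ U.card ≤ 25 * F.card * A.card ∧
      100 * (outerNeighbors G A U).card ≤ 99 * U.card := by
  by_contra! hno
  have hu : 0 < U.card := hne.card_pos
  have hr : 0 < F.card := by
    obtain ⟨x, hx⟩ := hne
    obtain ⟨B, hB, -⟩ := Finset.mem_biUnion.1 (hU hx)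
    exact Finset.card_pos.2 ⟨B, hB⟩
  -- A clique with at least |U|/25 vertices would be admissible, yet its outer neighbours lie
  -- outside it and so number at most 24|U|/25.
  have hsmall : ∀ A ⊆ U, G.IsClique (A : Set V) → 25 * A.card < U.card := by
    intro A hA hc
    by_contra! h
    have h₁ : U.card ≤ 25 * F.card * A.card := by nlinarith
    have h₂ := hno A hA hc h₁
    have h₃ := card_outerNeighbors_add_card_le (G := G) hA
    omega
  -- Vertices adjacent to nearly everything. Two non-adjacent ones would share at least 0.8|U|
  -- neighbours, which form a clique that is too large; so H is itself a clique, hence small, and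
  -- can be avoided.
  set H := U.filter fun v => 9 * U.card ≤ 10 * (U.filter (EqOrAdj G v)).card with hH
  have hHc : G.IsClique (H : Set V) := by
    intro x hx y hy hxy
    by_contra hadj
    have hx' := Finset.mem_filter.1 (Finset.mem_coe.1 hx)
    have hy' := Finset.mem_filter.1 (Finset.mem_coe.1 hy)
    have hB := hG.isClique_common hxy hadj
      (A := U.filter (EqOrAdj G x) ∩ U.filter (EqOrAdj G y)) (fun a ha => by
        simp only [Finset.mem_inter, Finset.mem_filter] at ha
        obtain ⟨⟨-, hxa⟩, -, hya⟩ := ha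
        rcases hxa with rfl | hxa
        · exact absurd (hya.resolve_left hxy.symm).symm hadj
        · rcases hya with rfl | hya
          · exact absurd hxa hadj
          · exact ⟨hxa, hya⟩)
    have h₁ := hsmall _ (Finset.inter_subset_left.trans (Finset.filter_subset _ _)) hB
    have h₂ := Finset.card_union_add_card_inter (U.filter (EqOrAdj G x)) (U.filter (EqOrAdj G y))
    have h₃ : (U.filter (EqOrAdj G x) ∪ U.filter (EqOrAdj G y)).card ≤ U.card :=
      Finset.card_le_card (Finset.union_subset (Finset.filter_subset _ _)
        (Finset.filter_subset _ _))
    omega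
  have hHU : H ⊆ U := Finset.filter_subset _ _
  have hHs := hsmall H hHU hHc
  obtain ⟨A, hAL, hAc, hAcard⟩ := exists_clique_of_cover hF (W := U \ H)
    (Finset.sdiff_subset.trans hU)
  rw [Finset.card_sdiff_of_subset hHU] at hAcard
  have hAU : A ⊆ U := hAL.trans Finset.sdiff_subset
  have hlow : ∀ a ∈ A, 10 * (U.filter (EqOrAdj G a)).card < 9 * U.card := by
    intro a ha
    have := hAL ha
    simp only [hH, Finset.mem_sdiff, Finset.mem_filter, not_and, not_le] at this
    exact this.2 this.1
  have hApos : 0 < A.card := by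
    rcases Nat.eq_zero_or_pos A.card with h | h
    · rw [h] at hAcard
      omega
    · exact h
  -- The trace of x on A. Every a in A misses a tenth of U, so by double counting the average trace
  -- is at most 0.9|A|, and a fixed proportion of U has trace at most 0.95|A|.
  set S : V → Finset V := fun x => A.filter (EqOrAdj G x) with hS
  have hdc : ∑ x ∈ U, (S x).card = ∑ a ∈ A, (U.filter (EqOrAdj G a)).card := by
    simp only [hS, Finset.card_filter]
    rw [Finset.sum_comm]
    refine Finset.sum_congr rfl fun a _ => Finset.sum_congr rfl fun x _ => ?_
    exact if_congr ⟨EqOrAdj.symm, EqOrAdj.symm⟩ rfl rfl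
  have hsum : 10 * ∑ x ∈ U, (S x).card ≤ 9 * U.card * A.card := by
    rw [hdc, Finset.mul_sum]
    calc _ ≤ ∑ _a ∈ A, 9 * U.card := Finset.sum_le_sum fun a ha => (hlow a ha).le
      _ = _ := by rw [Finset.sum_const, smul_eq_mul, mul_comm]
  set N := U.filter fun x => 20 * (S x).card ≤ 19 * A.card with hN
  have hNcard : U.card ≤ 19 * N.card := by
    have h₁ : ∑ x ∈ U \ N, 19 * A.card ≤ ∑ x ∈ U \ N, 20 * (S x).card :=
      Finset.sum_le_sum fun x hx => by
        simp only [hN, Finset.mem_sdiff, Finset.mem_filter, not_and, not_le] at hx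
        exact (hx.2 hx.1).le
    have h₂ : ∑ x ∈ U \ N, 20 * (S x).card ≤ 20 * ∑ x ∈ U, (S x).card := by
      rw [Finset.mul_sum]
      exact Finset.sum_le_sum_of_subset Finset.sdiff_subset
    rw [Finset.sum_const, smul_eq_mul] at h₁
    have h₃ : (U \ N).card * 19 ≤ 18 * U.card := by
      refine Nat.le_of_mul_le_mul_right ?_ hApos
      nlinarith
    have hNU : N ⊆ U := Finset.filter_subset _ _
    rw [Finset.card_sdiff_of_subset hNU] at h₃
    have h₄ : N.card ≤ U.card := Finset.card_le_card hNU
    omega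
  have hrA : 24 * U.card ≤ 25 * (F.card * A.card) := by omega
  set T := U.filter fun x => ∃ a ∈ A, EqOrAdj G x a with hT
  have hTcard : 99 * U.card < 100 * T.card := by
    have h₁ := hno A hAU hAc (by nlinarith)
    have h₂ : (outerNeighbors G A U).card ≤ T.card := Finset.card_le_card fun x hx => by
      obtain ⟨hxU, -, a, ha, hax⟩ := mem_outerNeighbors.1 hx
      exact Finset.mem_filter.2 ⟨hxU, a, ha, Or.inr hax.symm⟩
    omega
  -- Restricting to nonempty traces loses under |U|/100 vertices, and 1/19 − 1/100 > 1/25.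
  have hNT : U.card ≤ 25 * (N ∩ T).card := by
    have h₁ := Finset.card_union_add_card_inter N T
    have h₂ : (N ∪ T).card ≤ U.card :=
      Finset.card_le_card (Finset.union_subset (Finset.filter_subset _ _)
        (Finset.filter_subset _ _))
    omega
  have hNTU : N ∩ T ⊆ U := Finset.inter_subset_left.trans (Finset.filter_subset _ _)
  obtain ⟨D, hD, hDc, hDcard⟩ := exists_clique_of_cover hF (hNTU.trans hU)
  have hDne : D.Nonempty := by
    rw [← Finset.card_pos]
    rcases Nat.eq_zero_or_pos D.card with h | h
    · rw [h] at hDcard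
      omega
    · exact h
  have hnest : ∀ x y, EqOrAdj G x y → S x ⊆ S y ∨ S y ⊆ S x := by
    intro x y hxy
    refine (hG.nested hAc hxy).imp ?_ ?_ <;>
    · intro h a ha
      obtain ⟨ha, hxa⟩ := Finset.mem_filter.1 ha
      exact Finset.mem_filter.2 ⟨ha, h a ha hxa⟩
  have hle : ∀ x ∈ D, ∀ y ∈ D, (S x).card ≤ (S y).card → S x ⊆ S y := by
    intro x hx y hy hxy
    have : EqOrAdj G x y := or_iff_not_imp_left.2 fun h => hDc hx hy h
    rcases hnest x y this with h | h
    · exact h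
    · exact (Finset.eq_of_subset_of_card_le h hxy).symm.subset
  -- Traces of members of the clique D form a chain. The largest, that of p, still misses |A|/20
  -- vertices of A, so A \ S p is an admissible clique; the smallest, that of q, contains some b.
  obtain ⟨p, hp, hpmax⟩ := D.exists_max_image (fun x => (S x).card) hDne
  obtain ⟨q, hq, hqmin⟩ := D.exists_min_image (fun x => (S x).card) hDne
  have hp' := (Finset.mem_filter.1 (Finset.mem_inter.1 (hD hp)).1).2
  obtain ⟨b, hbA, hqb⟩ := (Finset.mem_filter.1 (Finset.mem_inter.1 (hD hq)).2).2
  have hSp : S p ⊆ A := Finset.filter_subset _ _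
  have hA'card : A.card ≤ 20 * (A \ S p).card := by
    rw [Finset.card_sdiff_of_subset hSp]
    omega
  have h₁ := hno (A \ S p) (Finset.sdiff_subset.trans hAU)
    (hAc.subset (by exact_mod_cast Finset.sdiff_subset)) (by nlinarith)
  have h₂ := hno D (hD.trans hNTU) hDc (by nlinarith)
  have h₃ := Finset.card_union_add_card_inter (outerNeighbors G (A \ S p) U)
    (outerNeighbors G D U)
  have h₄ : (outerNeighbors G (A \ S p) U ∪ outerNeighbors G D U).card ≤ U.card :=
    Finset.card_le_card (Finset.union_subset (Finset.filter_subset _ _)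
      (Finset.filter_subset _ _))
  -- If y is adjacent to some a in A \ S p and to some x in D, then a lies in S y but not in S x, so
  -- nestedness gives b ∈ S q ⊆ S x ⊆ S y. Thus b is a closed neighbour of over 98% of U, although
  -- members of A reach less than 90%.
  have h₅ : (outerNeighbors G (A \ S p) U ∩ outerNeighbors G D U).card ≤
      (U.filter (EqOrAdj G b)).card := Finset.card_le_card fun y hy => by
    obtain ⟨hy₁, hy₂⟩ := Finset.mem_inter.1 hy
    obtain ⟨hyU, -, a, ha, hay⟩ := mem_outerNeighbors.1 hy₁
    obtain ⟨-, -, x, hx, hxy⟩ := mem_outerNeighbors.1 hy₂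
    obtain ⟨haA, hap⟩ := Finset.mem_sdiff.1 ha
    refine Finset.mem_filter.2 ⟨hyU, ?_⟩
    have hxS : S x ⊆ S y := (hnest x y (Or.inr hxy)).resolve_right fun h =>
      hap (hle x hx p hp (hpmax x hx) (h (Finset.mem_filter.2 ⟨haA, Or.inr hay.symm⟩)))
    have hbq : b ∈ S q := Finset.mem_filter.2 ⟨hbA, hqb⟩
    exact (Finset.mem_filter.1 (hxS (hle q hq x hx (hqmin x hx) hbq))).2.symm
  have h₆ := hlow b hbA
  omega

end CliqueCover

/-! ### Large cliques from large degrees, and the decomposition of the graph -/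

section LargeClique

variable {V : Type*} [DecidableEq V] {G : SimpleGraph V}

/-- The private neighbours of a vertex of a maximum independent set form a clique. -/
theorem isClique_private_neighbors {W I : Finset V}
    (hIW : I ⊆ W) (hI : ∀ x ∈ I, ∀ y ∈ I, ¬ G.Adj x y)
    (hmax : ∀ J ⊆ W, (∀ x ∈ J, ∀ y ∈ J, ¬ G.Adj x y) → J.card ≤ I.card) {i : V} (hi : i ∈ I)
    {A : Finset V} (hA : ∀ v ∈ A, v ∈ W ∧ (v = i ∨ ∀ j ∈ I, G.Adj j v ↔ j = i)) :
    G.IsClique (A : Set V) := by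
  intro v hv w hw hvw
  obtain ⟨hvW, hv⟩ := hA v hv
  obtain ⟨hwW, hw⟩ := hA w hw
  rcases hv with rfl | hv
  · rcases hw with rfl | hw
    · exact absurd rfl hvw
    · exact (hw v hi).2 rfl
  rcases hw with rfl | hw
  · exact ((hv w hi).2 rfl).symm
  by_contra hadj
  have hvI : v ∉ I := fun h => hI i hi v h ((hv i hi).2 rfl)
  have hwI : w ∉ I := fun h => hI i hi w h ((hw i hi).2 rfl)
  -- Exchanging i for two non-adjacent private neighbours would give a larger independent set.
  have hcard : (insert v (insert w (I.erase i))).card = I.card + 1 := by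
    rw [Finset.card_insert_of_notMem (by simp [hvw, hvI]),
      Finset.card_insert_of_notMem (by simp [hwI]), Finset.card_erase_add_one hi]
  have hle := hmax (insert v (insert w (I.erase i))) (by
    intro x hx
    simp only [Finset.mem_insert, Finset.mem_erase] at hx
    rcases hx with rfl | rfl | ⟨-, hx⟩
    exacts [hvW, hwW, hIW hx]) (by
    intro x hx y hy hxy
    simp only [Finset.mem_insert, Finset.mem_erase] at hx hy
    rcases hx with rfl | rfl | ⟨hxi, hx⟩ <;> rcases hy with rfl | rfl | ⟨hyi, hy⟩
    · exact G.irrefl hxy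
    · exact hadj hxy
    · exact hyi ((hv y hy).1 hxy.symm)
    · exact hadj hxy.symm
    · exact G.irrefl hxy
    · exact hyi ((hw y hy).1 hxy.symm)
    · exact hxi ((hv x hx).1 hxy)
    · exact hxi ((hw x hx).1 hxy)
    · exact hI x hx y hy hxy)
  omega

variable [DecidableRel G.Adj]

/-- Many vertices of large degree which are pairwise non-adjacent yield a large clique. -/
theorem NoInducedSquare.exists_clique_of_independent (hG : NoInducedSquare G) {W I : Finset V}
    {d q : ℕ} (hI : ∀ x ∈ I, ∀ y ∈ I, ¬ G.Adj x y) (hW : 0 < W.card)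
    (hdeg : ∀ v ∈ I, d ≤ (W.filter (G.Adj v)).card) (hs : 2 * W.card ≤ I.card * d)
    (hq : q * I.card ^ 2 ≤ W.card) : ∃ A ⊆ W, G.IsClique (A : Set V) ∧ q ≤ A.card := by
  by_contra! hno
  have hpair : ∀ p ∈ I.offDiag, (W.filter fun w => G.Adj p.1 w ∧ G.Adj p.2 w).card + 1 ≤ q := by
    intro p hp
    obtain ⟨h₁, h₂, h₃⟩ := Finset.mem_offDiag.1 hp
    exact hno _ (Finset.filter_subset _ _)
      (hG.isClique_common h₃ (hI _ h₁ _ h₂) fun a ha => (Finset.mem_filter.1 ha).2)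
  have hsingle : ∑ w ∈ W, (I.filter fun i => G.Adj i w).card =
      ∑ i ∈ I, (W.filter (G.Adj i)).card := by
    simp only [Finset.card_filter]
    exact Finset.sum_comm
  have hdouble : ∑ w ∈ W, (I.filter fun i => G.Adj i w).offDiag.card =
      ∑ p ∈ I.offDiag, (W.filter fun w => G.Adj p.1 w ∧ G.Adj p.2 w).card := by
    have e : ∀ w, (I.filter fun i => G.Adj i w).offDiag =
        I.offDiag.filter fun p => G.Adj p.1 w ∧ G.Adj p.2 w := fun w => by
      ext p
      simp only [Finset.mem_offDiag, Finset.mem_filter]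
      tauto
    simp only [e, Finset.card_filter]
    exact Finset.sum_comm
  have h₁ : I.card * d ≤ ∑ i ∈ I, (W.filter (G.Adj i)).card := by
    rw [← smul_eq_mul, ← Finset.sum_const]
    exact Finset.sum_le_sum hdeg
  -- Termwise this is m ≤ m(m − 1) + 1, comparing the number of neighbours of w in I with the
  -- ordered pairs of them.
  have h₂ : ∑ w ∈ W, (I.filter fun i => G.Adj i w).card ≤
      ∑ w ∈ W, ((I.filter fun i => G.Adj i w).offDiag.card + 1) :=
    Finset.sum_le_sum fun w _ => by
      rw [Finset.offDiag_card]
      rcases Nat.lt_or_ge (I.filter fun i => G.Adj i w).card 2 with h | h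
      · omega
      · have := Nat.mul_le_mul_right (I.filter fun i => G.Adj i w).card h
        omega
  rw [Finset.sum_add_distrib, Finset.sum_const, smul_eq_mul, mul_one, hdouble, hsingle] at h₂
  -- The extra 1 per pair records that common neighbourhoods, being cliques, have fewer than q
  -- vertices. With 2|W| ≤ |I|d this slack leaves no room for any pair, and with no pairs the count
  -- says 2|W| ≤ |W|.
  have h₃ : ∑ p ∈ I.offDiag, ((W.filter fun w => G.Adj p.1 w ∧ G.Adj p.2 w).card + 1) ≤
      I.offDiag.card * q := by
    rw [← smul_eq_mul, ← Finset.sum_const]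
    exact Finset.sum_le_sum hpair
  rw [Finset.sum_add_distrib, Finset.sum_const, smul_eq_mul, mul_one] at h₃
  have h₄ : I.offDiag.card * q ≤ q * I.card ^ 2 := by
    rw [Finset.offDiag_card, mul_comm]
    exact Nat.mul_le_mul_left q (by rw [sq]; omega)
  have h₅ : I.offDiag.card = 0 := by omega
  rw [Finset.card_eq_zero] at h₅
  rw [h₅] at h₂
  simp only [Finset.sum_empty] at h₂
  omega

/-- A graph without induced 4-cycles is covered by `α ^ 2` cliques, `α` the independence number. -/
theorem NoInducedSquare.exists_cover_of_maximum_independent (hG : NoInducedSquare G)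
    {W I : Finset V} (hIW : I ⊆ W) (hI : ∀ x ∈ I, ∀ y ∈ I, ¬ G.Adj x y)
    (hmax : ∀ J ⊆ W, (∀ x ∈ J, ∀ y ∈ J, ¬ G.Adj x y) → J.card ≤ I.card) :
    ∃ F : Finset (Finset V), (∀ A ∈ F, G.IsClique (A : Set V)) ∧ W ⊆ F.biUnion id ∧
      F.card ≤ I.card ^ 2 := by
  -- A diagonal cell holds i and its private neighbours; an off-diagonal cell holds common
  -- neighbours. By maximality of I every vertex outside I has a neighbour in I, so the cells cover
  -- W.
  let cell : V × V → Finset V := fun p => W.filter fun w =>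
    if p.1 = p.2 then w = p.1 ∨ ∀ j ∈ I, G.Adj j w ↔ j = p.1 else G.Adj p.1 w ∧ G.Adj p.2 w
  have hcell : ∀ p w, w ∈ cell p ↔ w ∈ W ∧ if p.1 = p.2 then w = p.1 ∨
      ∀ j ∈ I, G.Adj j w ↔ j = p.1 else G.Adj p.1 w ∧ G.Adj p.2 w := fun p w =>
    Finset.mem_filter
  refine ⟨(I ×ˢ I).image cell, ?_, ?_, ?_⟩
  · intro A hA
    obtain ⟨⟨i, j⟩, hp, rfl⟩ := Finset.mem_image.1 hA
    obtain ⟨hi, hj⟩ := Finset.mem_product.1 hp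
    by_cases hij : i = j
    · refine isClique_private_neighbors hIW hI hmax hi fun v hv => ?_
      have := (hcell _ _).1 hv
      rwa [if_pos hij] at this
    · refine hG.isClique_common hij (hI i hi j hj) fun v hv => ?_
      have := (hcell _ _).1 hv
      rw [if_neg hij] at this
      exact this.2
  · intro w hw
    have key : ∃ p ∈ I ×ˢ I, w ∈ cell p := by
      by_cases hwI : w ∈ I
      · exact ⟨(w, w), Finset.mem_product.2 ⟨hwI, hwI⟩, (hcell _ _).2 ⟨hw, by simp⟩⟩
      by_cases hex : ∃ i ∈ I, G.Adj i w
      · obtain ⟨i, hi, hiw⟩ := hex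
        by_cases hex' : ∃ j ∈ I, i ≠ j ∧ G.Adj j w
        · obtain ⟨j, hj, hij, hjw⟩ := hex'
          exact ⟨(i, j), Finset.mem_product.2 ⟨hi, hj⟩,
            (hcell _ _).2 ⟨hw, by rw [if_neg hij]; exact ⟨hiw, hjw⟩⟩⟩
        · push Not at hex'
          refine ⟨(i, i), Finset.mem_product.2 ⟨hi, hi⟩, (hcell _ _).2 ⟨hw, ?_⟩⟩
          rw [if_pos rfl]
          refine Or.inr fun j hj => ⟨fun h => ?_, fun h => h ▸ hiw⟩
          by_contra hne
          exact hex' j hj (Ne.symm hne) h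
      · push Not at hex
        have := hmax (insert w I) (Finset.insert_subset hw hIW) (by
          intro x hx y hy hxy
          rcases Finset.mem_insert.1 hx with rfl | hxI <;>
            rcases Finset.mem_insert.1 hy with rfl | hyI
          · exact G.irrefl hxy
          · exact hex y hyI hxy.symm
          · exact hex x hxI hxy
          · exact hI x hxI y hyI hxy)
        rw [Finset.card_insert_of_notMem hwI] at this
        omega
    obtain ⟨p, hp, hwp⟩ := key
    exact Finset.mem_biUnion.2 ⟨cell p, Finset.mem_image_of_mem _ hp, hwp⟩
  · refine Finset.card_image_le.trans ?_
    rw [Finset.card_product, sq]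

/-- Large minimum degree forces a large clique. -/
theorem NoInducedSquare.exists_clique_of_min_degree (hG : NoInducedSquare G) {W : Finset V}
    {d s q : ℕ} (hW : W.Nonempty) (hdeg : ∀ v ∈ W, d ≤ (W.filter (G.Adj v)).card)
    (hs : 2 * W.card ≤ s * d) (hq : q * s ^ 2 ≤ d) :
    ∃ A ⊆ W, G.IsClique (A : Set V) ∧ q ≤ A.card := by
  have hWpos := hW.card_pos
  have hdW : d ≤ W.card := by
    obtain ⟨v, hv⟩ := hW
    exact (hdeg v hv).trans (Finset.card_le_card (Finset.filter_subset _ _))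
  obtain ⟨I, hI, hmax⟩ := (W.powerset.filter fun J =>
    ∀ x ∈ J, ∀ y ∈ J, ¬ G.Adj x y).exists_max_image Finset.card ⟨∅, by simp⟩
  simp only [Finset.mem_filter, Finset.mem_powerset] at hI hmax
  obtain ⟨hIW, hI⟩ := hI
  -- Either the independence number is below s, and one of fewer than s² covering cliques is large,
  -- or s independent vertices of degree at least d are available for the pair count.
  rcases Nat.lt_or_ge I.card s with h | h
  · obtain ⟨F, hF, hcov, hcard⟩ := hG.exists_cover_of_maximum_independent hIW hI
      fun J hJ hJ' => hmax J ⟨hJ, hJ'⟩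
    obtain ⟨D, hD, hDc, hDcard⟩ := exists_clique_of_cover hF hcov
    refine ⟨D, hD, hDc, ?_⟩
    have hs2 : 0 < s ^ 2 := pow_pos (by omega) 2
    refine Nat.le_of_mul_le_mul_right ?_ hs2
    have h₁ : I.card ^ 2 ≤ s ^ 2 := Nat.pow_le_pow_left h.le 2
    have h₂ : F.card * D.card ≤ s ^ 2 * D.card := Nat.mul_le_mul_right _ (hcard.trans h₁)
    nlinarith
  · obtain ⟨J, hJI, hJ⟩ := Finset.exists_subset_card_eq h
    exact hG.exists_clique_of_independent (I := J) (fun x hx y hy => hI x (hJI hx) y (hJI hy)) hWpos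
      (fun v hv => hdeg v (hIW (hJI hv))) (hJ ▸ hs) (hJ ▸ hq.trans hdW)

/-- A graph without induced 4-cycles splits into few large cliques and a degenerate remainder. -/
theorem NoInducedSquare.exists_cliques_and_degenerate (hG : NoInducedSquare G) {n d s q : ℕ}
    (hs : 2 * n ≤ s * d) (hq : q * s ^ 2 ≤ d) (hq0 : 0 < q) (m : ℕ) :
    ∀ S : Finset V, S.card = m → m ≤ n →
    ∃ F : Finset (Finset V), (∀ A ∈ F, G.IsClique (A : Set V)) ∧ F.card * q ≤ S.card ∧
      ∃ R : Finset V, S ⊆ F.biUnion id ∪ R ∧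
        ∀ W ⊆ R, W.Nonempty → ∃ v ∈ W, (W.filter (G.Adj v)).card < d := by
  induction m using Nat.strong_induction_on with
  | _ m ih =>
    intro S hm hn
    -- Greedy peeling: a subset of minimum degree at least d yields a clique with at least q
    -- vertices to remove; when none is left, the current set is the degenerate remainder.
    by_cases hW : ∃ W ⊆ S, W.Nonempty ∧ ∀ v ∈ W, d ≤ (W.filter (G.Adj v)).card
    · obtain ⟨W, hWS, hW, hdeg⟩ := hW
      have hWc := Finset.card_le_card hWS
      obtain ⟨A, hAW, hAc, hA⟩ := hG.exists_clique_of_min_degree hW hdeg (by omega) hq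
      have hAS := hAW.trans hWS
      have hsd := Finset.card_sdiff_add_card_eq_card hAS
      obtain ⟨F, hF, hFc, R, hSR, hR⟩ := ih (S \ A).card (by omega) (S \ A) rfl (by omega)
      refine ⟨insert A F, ?_, ?_, R, ?_, hR⟩
      · intro B hB
        rcases Finset.mem_insert.1 hB with rfl | hB
        exacts [hAc, hF B hB]
      · have := Nat.mul_le_mul_right q (Finset.card_insert_le A F)
        rw [add_mul, one_mul] at this
        omega
      · intro x hx
        by_cases hxA : x ∈ A
        · simp [hxA]
        · have := hSR (Finset.mem_sdiff.2 ⟨hx, hxA⟩)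
          simp only [Finset.biUnion_insert, Finset.mem_union] at this ⊢
          tauto
    · push Not at hW
      exact ⟨∅, by simp, by simp, S, by simp, hW⟩

end LargeClique

/-! ### Bounding the Betti number of clique part plus degenerate remainder -/

section Recursion

variable (K : Type*) [Field K] {V : Type*} [LinearOrder V] [Fintype V] {G : SimpleGraph V}
  [DecidableRel G.Adj]

/-- Delete the vertices of W in degeneracy order: each has fewer than d neighbours in the current W
and at most m in U, so each deletion costs at most B, and U alone costs one more B. -/
theorem inducedBetti_union_le_of_degenerate {R : Finset V} {m d : ℕ} {B : ℝ}
    (hR : ∀ W ⊆ R, W.Nonempty → ∃ v ∈ W, (W.filter (G.Adj v)).card < d)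
    (hB : ∀ S : Finset V, S.card ≤ m + d → (inducedBetti K G S : ℝ) ≤ B) (k : ℕ) :
    ∀ W ⊆ R, W.card = k → ∀ U : Finset V, U.card ≤ m →
      (inducedBetti K G (U ∪ W) : ℝ) ≤ (k + 1) * B := by
  induction k with
  | zero =>
    intro W _ hW U hU
    rw [Finset.card_eq_zero.1 hW]
    simpa using hB U (by omega)
  | succ k ih =>
    intro W hWR hW U hU
    obtain ⟨v, hv, hdeg⟩ := hR W hWR (Finset.card_pos.1 (by omega))
    have h₁ := inducedBetti_le_erase_add_neighbors K (G := G) (Finset.mem_union_right U hv)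
    have h₂ : (U ∪ W).erase v = U.erase v ∪ W.erase v := Finset.erase_union_distrib U W v
    have h₃ := ih (W.erase v) ((Finset.erase_subset v W).trans hWR)
      (by rw [Finset.card_erase_of_mem hv]; omega) (U.erase v)
      ((Finset.card_le_card (Finset.erase_subset v U)).trans hU)
    have h₄ := hB ((U ∪ W).filter (G.Adj v)) (by
      rw [Finset.filter_union]
      have := Finset.card_union_le (U.filter (G.Adj v)) (W.filter (G.Adj v))
      have := Finset.card_le_card (Finset.filter_subset (G.Adj v) U)
      omega)
    rw [h₂] at h₁
    have h₅ : (inducedBetti K G (U ∪ W) : ℝ) ≤ inducedBetti K G (U.erase v ∪ W.erase v) +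
        inducedBetti K G ((U ∪ W).filter (G.Adj v)) := by exact_mod_cast h₁
    push_cast
    linarith

/-- One round of clique deletions, from |U| ≤ s down to |U| ≤ 0.99s. The arbitrary W ⊆ R is carried
along because deletion and outer neighbourhoods also cut down the remainder part. -/
theorem NoInducedSquare.inducedBetti_union_le_of_cover (hG : NoInducedSquare G)
    {F : Finset (Finset V)} (hF : ∀ A ∈ F, G.IsClique (A : Set V)) {R : Finset V} {s M : ℝ}
    (hs : 0 ≤ s)
    (hM : ∀ U ⊆ F.biUnion id, (U.card : ℝ) ≤ 99 / 100 * s → ∀ W ⊆ R,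
      (inducedBetti K G (U ∪ W) : ℝ) ≤ M) :
    ∀ U ⊆ F.biUnion id, (U.card : ℝ) ≤ s → ∀ W ⊆ R,
      (inducedBetti K G (U ∪ W) : ℝ) ≤ (1 + 30 * F.card) * M := by
  have hM0 : 0 ≤ M := by
    have h₁ := hM ∅ (by simp) (by simpa using by positivity) ∅ (by simp)
    have h₂ : (0 : ℝ) ≤ inducedBetti K G (∅ ∪ ∅) := by exact_mod_cast inducedBetti_nonneg K G _
    exact h₂.trans h₁
  -- A bound linear in |U|, multiplied through by s to avoid division: deleting A lowers the right
  -- side by 30|F||A|M, which must pay for sM.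
  have key : ∀ m : ℕ, ∀ U ⊆ F.biUnion id, U.card = m → (U.card : ℝ) ≤ s → ∀ W ⊆ R,
      s * (inducedBetti K G (U ∪ W) : ℝ) ≤ (s + 30 * F.card * U.card) * M := by
    intro m
    induction m using Nat.strong_induction_on with
    | _ m ih =>
      intro U hU hm hUs W hW
      rcases le_or_gt (U.card : ℝ) (99 / 100 * s) with h | h
      · have h₁ := mul_le_mul_of_nonneg_left (hM U hU h W hW) hs
        have h₂ : 0 ≤ 30 * (F.card : ℝ) * U.card * M := by positivity
        linarith
      · have hpos : 0 < U.card := by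
          have : (0 : ℝ) < U.card := lt_of_le_of_lt (by positivity) h
          exact_mod_cast this
        obtain ⟨A, hAU, hAc, hAcard, hAout⟩ :=
          hG.exists_clique_few_outerNeighbors hF hU (Finset.card_pos.1 hpos)
        have hA : A.Nonempty := by
          rw [← Finset.card_pos]
          rcases Nat.eq_zero_or_pos A.card with h0 | h0
          · rw [h0] at hAcard
            omega
          · exact h0
        have hstep := inducedBetti_le_sdiff_add_outerNeighbors K hG
          (hAU.trans (Finset.subset_union_left (s₂ := W))) hA hAc
        have e₁ : (U ∪ W) \ A = (U \ A) ∪ (W \ A) := Finset.union_sdiff_distrib U W A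
        have e₂ : outerNeighbors G A (U ∪ W) = outerNeighbors G A U ∪ outerNeighbors G A W :=
          Finset.filter_union _ _ _
        have hsd := Finset.card_sdiff_add_card_eq_card hAU
        have hsd' : ((U \ A).card : ℝ) + A.card = U.card := by exact_mod_cast hsd
        have hApos := hA.card_pos
        have h₁ := ih (U \ A).card (by omega) (U \ A) (Finset.sdiff_subset.trans hU) rfl
          (by have : (0 : ℝ) ≤ A.card := Nat.cast_nonneg _
              linarith) (W \ A) (Finset.sdiff_subset.trans hW)
        have hout : (100 : ℝ) * (outerNeighbors G A U).card ≤ 99 * U.card := by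
          exact_mod_cast hAout
        have h₂ := hM (outerNeighbors G A U) ((Finset.filter_subset _ _).trans hU) (by linarith)
          (outerNeighbors G A W) ((Finset.filter_subset _ _).trans hW)
        rw [e₁, e₂] at hstep
        have hstep' : (inducedBetti K G (U ∪ W) : ℝ) ≤ inducedBetti K G (U \ A ∪ W \ A) +
            inducedBetti K G (outerNeighbors G A U ∪ outerNeighbors G A W) := by
          exact_mod_cast hstep
        have hAcard' : (U.card : ℝ) ≤ 25 * F.card * A.card := by exact_mod_cast hAcard
        -- Here s < (100/99)|U| and 25 · 100/99 < 30.
        have h₃ : s ≤ 30 * F.card * A.card := by linarith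
        have h₄ := mul_le_mul_of_nonneg_left hstep' hs
        have h₅ := mul_le_mul_of_nonneg_left h₂ hs
        have h₆ := mul_le_mul_of_nonneg_right h₃ hM0
        rw [← hsd']
        linarith
  intro U hU hUs W hW
  rcases hs.eq_or_lt with rfl | hs'
  · have h₁ := hM U hU (by linarith) W hW
    have h₂ : 0 ≤ 30 * (F.card : ℝ) * M := by positivity
    linarith
  · have h₁ := key _ U hU rfl hUs W hW
    have h₂ : (s + 30 * F.card * U.card) * M ≤ s * ((1 + 30 * F.card) * M) := by
      have : 30 * (F.card : ℝ) * U.card * M ≤ 30 * F.card * s * M := by gcongr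
      linarith
    exact le_of_mul_le_mul_left (h₁.trans h₂) hs'

theorem NoInducedSquare.inducedBetti_union_le_pow (hG : NoInducedSquare G)
    {F : Finset (Finset V)} (hF : ∀ A ∈ F, G.IsClique (A : Set V)) {R : Finset V} (j : ℕ) :
    ∀ {s M : ℝ}, 0 ≤ s → (∀ U ⊆ F.biUnion id, (U.card : ℝ) ≤ (99 / 100) ^ j * s → ∀ W ⊆ R,
      (inducedBetti K G (U ∪ W) : ℝ) ≤ M) →
    ∀ U ⊆ F.biUnion id, (U.card : ℝ) ≤ s → ∀ W ⊆ R,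
      (inducedBetti K G (U ∪ W) : ℝ) ≤ (1 + 30 * F.card) ^ j * M := by
  induction j with
  | zero => intro s M _ hM; simpa using hM
  | succ j ih =>
    intro s M hs hM
    have h := ih hs (M := (1 + 30 * F.card) * M) (hG.inducedBetti_union_le_of_cover K hF
      (by positivity) (fun U hU hUs => hM U hU (by rw [pow_succ]; linarith)))
    intro U hU hUs W hW
    rw [pow_succ, mul_assoc]
    exact h U hU hUs W hW

end Recursion

/-! ### Solving the recursion -/

section UpperBound

variable (K : Type*) [Field K] {V : Type*} [LinearOrder V] [Fintype V] {G : SimpleGraph V}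

/-- One recursion step with degree threshold d = n/t: after j rounds the clique part has at most d
vertices, so each vertex deletion from the remainder involves at most 2d. The base 1 + 1920t³ is 1 +
30 · 64t³, with 64t³ bounding the number of cliques. -/
theorem NoInducedSquare.inducedBetti_le_of_smaller [DecidableRel G.Adj] (hG : NoInducedSquare G)
    {n t j : ℕ} {B : ℝ}
    (ht : 0 < t) (hnt : 16 * t ^ 2 ≤ n / t) (hj : (99 / 100 : ℝ) ^ j * t ≤ 1) {S : Finset V}
    (hS : S.card = n)
    (hB : ∀ S' : Finset V, S'.card ≤ 2 * (n / t) → (inducedBetti K G S' : ℝ) ≤ B) :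
    (inducedBetti K G S : ℝ) ≤ (1 + 1920 * (t : ℝ) ^ 3) ^ j * ((n + 1) * B) := by
  have hB0 : 0 ≤ B := by
    have h₂ : (0 : ℝ) ≤ inducedBetti K G ∅ := by exact_mod_cast inducedBetti_nonneg K G _
    exact h₂.trans (hB ∅ (by simp))
  set d := n / t with hd
  have ht2 : 0 < 16 * t ^ 2 := by positivity
  have hd1 : 1 ≤ d := by omega
  have hn : n ≤ 2 * (d * t) := by
    have h₁ : n < (d + 1) * t := by
      rw [hd, ← Nat.div_lt_iff_lt_mul ht]
      omega
    nlinarith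
  set q := d / (16 * t ^ 2) with hq
  have hq1 : 1 ≤ q := (Nat.one_le_div_iff ht2).2 hnt
  have hqd : q * (16 * t ^ 2) ≤ d := Nat.div_mul_le_self _ _
  have hdq : d ≤ 32 * t ^ 2 * q := by
    have h₁ : d < (q + 1) * (16 * t ^ 2) := by
      rw [hq, ← Nat.div_lt_iff_lt_mul ht2]
      omega
    nlinarith
  -- The independence threshold 4t satisfies 2n ≤ 4t · d since n ≤ 2dt, and q was chosen as d/(4t)²
  -- rounded down.
  obtain ⟨F, hF, hFq, R, hSR, hR⟩ := hG.exists_cliques_and_degenerate (n := n) (d := d)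
    (s := 4 * t) (q := q) (by nlinarith) (by nlinarith) hq1 n S hS le_rfl
  have hFt : F.card ≤ 64 * t ^ 3 := by
    refine Nat.le_of_mul_le_mul_right ?_ hq1
    calc F.card * q ≤ 2 * (d * t) := by omega
      _ ≤ 2 * (32 * t ^ 2 * q * t) := by gcongr
      _ = 64 * t ^ 3 * q := by ring
  have hFt' : (F.card : ℝ) ≤ 64 * (t : ℝ) ^ 3 := by exact_mod_cast hFt
  have hM : ∀ U ⊆ F.biUnion id, (U.card : ℝ) ≤ (99 / 100) ^ j * (n : ℝ) → ∀ W ⊆ S ∩ R,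
      (inducedBetti K G (U ∪ W) : ℝ) ≤ (n + 1) * B := by
    intro U _ hUn W hW
    have hUd : U.card ≤ d := by
      rw [hd, Nat.le_div_iff_mul_le ht]
      have h₁ : (U.card : ℝ) * t ≤ n := by
        calc (U.card : ℝ) * t ≤ (99 / 100) ^ j * (n : ℝ) * t := by gcongr
          _ = (99 / 100) ^ j * (t : ℝ) * n := by ring
          _ ≤ 1 * n := by gcongr
          _ = n := one_mul _
      exact_mod_cast h₁
    have hWn : W.card ≤ n := by
      rw [← hS]
      exact Finset.card_le_card (hW.trans Finset.inter_subset_left)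
    have h₁ := inducedBetti_union_le_of_degenerate K (m := d) hR
      (fun S' hS' => hB S' (by omega)) W.card W (hW.trans Finset.inter_subset_right) rfl U hUd
    refine h₁.trans ?_
    gcongr
  have hfin := hG.inducedBetti_union_le_pow K hF j (s := n) (Nat.cast_nonneg n) hM
    (S ∩ F.biUnion id) Finset.inter_subset_right
    (by rw [← hS]; exact_mod_cast Finset.card_le_card Finset.inter_subset_left) (S ∩ R) le_rfl
  rw [← Finset.inter_union_distrib_left, Finset.inter_eq_left.2 hSR] at hfin
  exact hfin.trans (mul_le_mul_of_nonneg_right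
    (pow_le_pow_left₀ (by positivity) (by linarith) j) (by positivity))

theorem NoInducedSquare.inducedBetti_le_exp [DecidableRel G.Adj] (hG : NoInducedSquare G) (n : ℕ) :
    ∀ S : Finset V, S.card = n → (inducedBetti K G S : ℝ) ≤
      Real.exp (Real.exp 100 + 812 * (Real.log n * √(Real.log n))) := by
  induction n using Nat.strong_induction_on with
  | _ n ih =>
    intro S hS
    have hlog : 0 ≤ Real.log n := Real.log_natCast_nonneg n
    rcases le_or_gt (Real.log n) 100 with hx | hx
    · have hn : (n : ℝ) ≤ Real.exp 100 := by
        rcases Nat.eq_zero_or_pos n with rfl | h0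
        · simpa using (Real.exp_pos 100).le
        · exact (Real.log_le_iff_le_exp (by exact_mod_cast h0)).1 hx
      have h₁ : (inducedBetti K G S : ℝ) ≤ 2 ^ n := by
        rw [← hS]
        exact_mod_cast inducedBetti_le_two_pow K G S
      have h₂ : (2 : ℝ) ^ n ≤ Real.exp n := by
        rw [← Real.exp_one_pow]
        gcongr
        linarith [Real.exp_one_gt_d9]
      refine h₁.trans (h₂.trans (Real.exp_le_exp.2 ?_))
      have : 0 ≤ Real.log n * √(Real.log n) := by positivity
      linarith
    · set x := Real.log n with hxdef
      set y := √x with hy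
      have hyx : y * y = x := Real.mul_self_sqrt hlog
      have hy10 : 10 < y := by
        rw [hy, Real.lt_sqrt (by norm_num)]
        linarith
      have hn0 : 0 < n := by
        rcases Nat.eq_zero_or_pos n with h | h
        · rw [hxdef, h] at hx
          norm_num at hx
        · exact h
      have hn0' : (0 : ℝ) < n := by exact_mod_cast hn0
      have hnx : (n : ℝ) = Real.exp x := (Real.exp_log hn0').symm
      have he : (2.7 : ℝ) < Real.exp 1 := by linarith [Real.exp_one_gt_d9]
      have he3 : (16 : ℝ) ≤ Real.exp 3 := by
        have : Real.exp 3 = Real.exp 1 ^ 3 := by rw [← Real.exp_nat_mul]; norm_num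
        rw [this]
        calc (16 : ℝ) ≤ 2.7 ^ 3 := by norm_num
          _ ≤ _ := by gcongr
      have he10 : (1921 : ℝ) ≤ Real.exp y := by
        have : Real.exp 10 = Real.exp 1 ^ 10 := by rw [← Real.exp_nat_mul]; norm_num
        calc (1921 : ℝ) ≤ 2.7 ^ 10 := by norm_num
          _ ≤ Real.exp 1 ^ 10 := by gcongr
          _ = Real.exp 10 := this.symm
          _ ≤ Real.exp y := Real.exp_le_exp.2 hy10.le
      -- With y = √(log n), one recursion step divides n by roughly eʸ while costing only exp(O(y²))
      -- = exp(O(log n)).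
      set t := ⌊Real.exp y⌋₊ with ht
      have htle : (t : ℝ) ≤ Real.exp y := Nat.floor_le (Real.exp_pos y).le
      have htge : Real.exp y ≤ 2 * t := by
        have := Nat.lt_floor_add_one (Real.exp y)
        rw [← ht] at this
        linarith
      have ht0' : (0 : ℝ) < t := by linarith
      have ht0 : 0 < t := by exact_mod_cast ht0'
      have hpow : ∀ k : ℕ, Real.exp y ^ k = Real.exp (k * y) := fun k => by
        rw [← Real.exp_nat_mul]
      have hnt : 16 * t ^ 2 ≤ n / t := by
        rw [Nat.le_div_iff_mul_le ht0]
        have : (16 : ℝ) * t ^ 2 * t ≤ n := by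
          calc (16 : ℝ) * t ^ 2 * t = 16 * t ^ 3 := by ring
            _ ≤ Real.exp 3 * Real.exp y ^ 3 := by gcongr
            _ = Real.exp (3 + 3 * y) := by rw [hpow, ← Real.exp_add]; norm_num
            _ ≤ Real.exp x := Real.exp_le_exp.2 (by nlinarith)
            _ = n := hnx.symm
        exact_mod_cast this
      -- Since 0.99 ≤ exp(−1/100), this many rounds shrink by a factor at least eʸ ≥ t.
      set j := ⌈100 * y⌉₊ with hjdef
      have hjge : 100 * y ≤ j := Nat.le_ceil _
      have hjle : (j : ℝ) ≤ 101 * y := by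
        have := Nat.ceil_lt_add_one (a := 100 * y) (by linarith)
        linarith
      have hj : (99 / 100 : ℝ) ^ j * t ≤ 1 := by
        have h₁ : (99 / 100 : ℝ) ≤ Real.exp (-1 / 100) := by
          have := Real.add_one_le_exp (-1 / 100 : ℝ)
          linarith
        calc (99 / 100 : ℝ) ^ j * t ≤ Real.exp (-1 / 100) ^ j * Real.exp y := by gcongr
          _ = Real.exp (j * (-1 / 100) + y) := by rw [← Real.exp_nat_mul, ← Real.exp_add]
          _ ≤ Real.exp 0 := Real.exp_le_exp.2 (by linarith)
          _ = 1 := Real.exp_zero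
      have hz : 0 ≤ x - y / 2 := by nlinarith
      have hB : ∀ S' : Finset V, S'.card ≤ 2 * (n / t) → (inducedBetti K G S' : ℝ) ≤
          Real.exp (Real.exp 100 + 812 * ((x - y / 2) * y)) := by
        intro S' hS'
        -- From 2n/t ≤ 4n e^{−y} and 4 ≤ e^{y/2}.
        have h₁ : (S'.card : ℝ) ≤ Real.exp (x - y / 2) := by
          have h₂ : (S'.card : ℝ) * t ≤ 2 * n := by
            have : S'.card * t ≤ 2 * n := by
              calc S'.card * t ≤ 2 * (n / t) * t := Nat.mul_le_mul_right t hS'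
                _ = 2 * (n / t * t) := by ring
                _ ≤ 2 * n := Nat.mul_le_mul_left 2 (Nat.div_mul_le_self n t)
            exact_mod_cast this
          have h₃ : (4 : ℝ) ≤ Real.exp (y / 2) := by
            have := Real.add_one_le_exp (y / 2)
            linarith
          have h₄ : Real.exp (x - y / 2) * Real.exp y = n * Real.exp (y / 2) := by
            rw [hnx, ← Real.exp_add, ← Real.exp_add]
            ring_nf
          have h₅ : (S'.card : ℝ) * Real.exp y ≤ Real.exp (x - y / 2) * Real.exp y := by
            rw [h₄]
            have h₆ : (S'.card : ℝ) * Real.exp y ≤ S'.card * (2 * t) :=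
              mul_le_mul_of_nonneg_left htge (Nat.cast_nonneg _)
            nlinarith
          exact le_of_mul_le_mul_right h₅ (Real.exp_pos y)
        have hlt : S'.card < n := by
          have : (S'.card : ℝ) < n := by
            refine h₁.trans_lt ?_
            rw [hnx]
            exact Real.exp_lt_exp.2 (by linarith)
          exact_mod_cast this
        refine (ih _ hlt S' rfl).trans (Real.exp_le_exp.2 ?_)
        have hl0 : 0 ≤ Real.log S'.card := Real.log_natCast_nonneg _
        have hlz : Real.log S'.card ≤ x - y / 2 := by
          rcases Nat.eq_zero_or_pos S'.card with h | h
          · rw [h]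
            simpa using hz
          · exact (Real.log_le_iff_le_exp (by exact_mod_cast h)).2 h₁
        have hsq : √(Real.log S'.card) ≤ y := Real.sqrt_le_sqrt (by linarith)
        have := mul_le_mul hlz hsq (Real.sqrt_nonneg _) hz
        linarith
      refine (hG.inducedBetti_le_of_smaller K ht0 hnt hj hS hB).trans ?_
      have hp : (1 + 1920 * (t : ℝ) ^ 3) ^ j ≤ Real.exp (404 * x) := by
        have h₁ : 1 + 1920 * (t : ℝ) ^ 3 ≤ Real.exp (4 * y) := by
          have h₂ : (1 : ℝ) ≤ Real.exp y ^ 3 := one_le_pow₀ (by linarith)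
          calc 1 + 1920 * (t : ℝ) ^ 3 ≤ Real.exp y ^ 3 + 1920 * Real.exp y ^ 3 := by gcongr
            _ = 1921 * Real.exp y ^ 3 := by ring
            _ ≤ Real.exp y * Real.exp y ^ 3 := by gcongr
            _ = Real.exp y ^ 4 := by ring
            _ = Real.exp (4 * y) := by rw [hpow]; norm_num
        calc (1 + 1920 * (t : ℝ) ^ 3) ^ j ≤ Real.exp (4 * y) ^ j := by gcongr
          _ = Real.exp (j * (4 * y)) := by rw [← Real.exp_nat_mul]
          _ ≤ Real.exp (404 * x) := Real.exp_le_exp.2 (by nlinarith)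
      have hn1 : (n : ℝ) + 1 ≤ Real.exp (2 * x) := by
        have h₁ : (1 : ℝ) ≤ n := by exact_mod_cast hn0
        have h₂ : (2 : ℝ) ≤ Real.exp x := by
          have := Real.add_one_le_exp x
          linarith
        calc (n : ℝ) + 1 ≤ 2 * n := by linarith
          _ ≤ Real.exp x * Real.exp x := by rw [hnx]; gcongr
          _ = Real.exp (2 * x) := by rw [← Real.exp_add]; ring_nf
      calc (1 + 1920 * (t : ℝ) ^ 3) ^ j *
            ((n + 1) * Real.exp (Real.exp 100 + 812 * ((x - y / 2) * y)))
          ≤ Real.exp (404 * x) *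
            (Real.exp (2 * x) * Real.exp (Real.exp 100 + 812 * ((x - y / 2) * y))) := by gcongr
        _ = Real.exp (Real.exp 100 + 812 * (x * y)) := by
          rw [← Real.exp_add, ← Real.exp_add]
          congr 1
          -- The decrease 812 · (y/2) · y = 406x in the exponent pays exactly for the factors
          -- exp(404x) and exp(2x).
          linear_combination 406 * (-hyx)

/-! ### From graded to ungraded Betti numbers -/

variable (G)

theorem finrank_reducedHomology_add (k : ℕ) :
    finrank K (ReducedHomology K G k) + finrank K (boundaries K G k) =
      finrank K (cycles K G k) := by
  rw [← (Submodule.submoduleOfEquivOfLe (boundaries_le_cycles K G k)).finrank_eq]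
  exact Submodule.finrank_quotient_add_finrank _

/-- The cliques with fewer than `N` vertices. -/
def cliquesBelow {V : Type*} (G : SimpleGraph V) (N : ℕ) : Set (Finset V) :=
  {s | G.IsClique (s : Set V) ∧ s.card < N}

/-- Cycles of different degrees have disjoint supports, so the spaces are independent inside the
ungraded kernel. -/
theorem sum_finrank_cycles_le (N : ℕ) :
    ∑ k ∈ Finset.range N, finrank K (cycles K G k) ≤
      finrank K (supportedOn K (cliquesBelow G N) ⊓
        LinearMap.ker (boundary K V) : Submodule K (Finset V → K)) := by
  induction N with
  | zero => simp
  | succ N ih =>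
    rw [Finset.sum_range_succ]
    refine (Nat.add_le_add_right ih _).trans ?_
    rw [← Submodule.finrank_sup_add_finrank_inf_eq]
    have hbot : (supportedOn K (cliquesBelow G N) ⊓
        LinearMap.ker (boundary K V)) ⊓ cycles K G N = ⊥ := by
      rw [eq_bot_iff]
      rintro f ⟨⟨hf, -⟩, hf', -⟩
      refine (Submodule.mem_bot K).2 (funext fun s => ?_)
      by_contra hs
      exact absurd (hf' s hs).card_eq (hf s hs).2.ne
    rw [hbot, finrank_bot, add_zero]
    refine Submodule.finrank_mono (sup_le ?_ ?_)
    · exact inf_le_inf_right _ (supportedOn_mono fun s hs => ⟨hs.1, hs.2.trans N.lt_succ_self⟩)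
    · exact inf_le_inf_right _ fun f hf s hs =>
        ⟨(hf s hs).isClique, (hf s hs).card_eq ▸ N.lt_succ_self⟩

/-- Boundaries indexed by k come from cliques of size k + 1, and the empty clique has zero boundary;
hence sizes up to N match indices below N. -/
theorem finrank_map_boundary_le_sum (N : ℕ) :
    finrank K ((supportedOn K (cliquesBelow G (N + 1))).map (boundary K V)) ≤
      ∑ k ∈ Finset.range N, finrank K (boundaries K G k) := by
  induction N with
  | zero =>
    have hbot : (supportedOn K (cliquesBelow G (0 + 1))).map (boundary K V) =
        ⊥ := by
      rw [eq_bot_iff]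
      rintro _ ⟨f, hf, rfl⟩
      refine (Submodule.mem_bot K).2 (funext fun t => ?_)
      refine Finset.sum_eq_zero fun v _ => ?_
      by_contra h
      have := (hf _ (right_ne_zero_of_mul h)).2
      have := Finset.card_pos.2 ⟨v, Finset.mem_insert_self v t⟩
      omega
    rw [hbot]
    simp
  | succ N ih =>
    have hU : cliquesBelow G (N + 1 + 1) ⊆
        (cliquesBelow G (N + 1)) ∪ {s : Finset V | G.IsNClique (N + 1) s} := by
      rintro s ⟨hs, hc⟩
      rcases Nat.lt_succ_iff_lt_or_eq.1 hc with h | h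
      · exact Or.inl ⟨hs, h⟩
      · exact Or.inr ⟨hs, h⟩
    rw [Finset.sum_range_succ]
    refine (Submodule.finrank_mono (Submodule.map_mono (supportedOn_mono hU))).trans ?_
    rw [supportedOn_union, Submodule.map_sup]
    exact (Submodule.finrank_add_le_finrank_add_finrank _ _).trans (Nat.add_le_add_right ih _)

/-- Both sides are dim ker ∂ minus rank ∂, summed by degree on the left and taken at once on the
right; the upper bound needs only this direction. -/
theorem totalBetti_le_inducedBetti : (totalBetti K G : ℤ) ≤ inducedBetti K G Finset.univ := by
  set P := supportedOn K (cliquesIn G Finset.univ) with hP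
  have h₁ := finrank_map_add_finrank_inf_ker (boundary K V) P
  have h₂ := sum_finrank_cycles_le K G (Fintype.card V + 1)
  have h₃ := finrank_map_boundary_le_sum K G (Fintype.card V + 1)
  have h₄ : totalBetti K G + ∑ k ∈ Finset.range (Fintype.card V + 1), finrank K (boundaries K G k) =
      ∑ k ∈ Finset.range (Fintype.card V + 1), finrank K (cycles K G k) := by
    rw [totalBetti, ← Finset.sum_add_distrib]
    exact Finset.sum_congr rfl fun k _ => finrank_reducedHomology_add K G k
  have h₅ : finrank K (supportedOn K (cliquesBelow G (Fintype.card V + 1)) ⊓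
        LinearMap.ker (boundary K V) : Submodule K (Finset V → K)) ≤
      finrank K (P ⊓ LinearMap.ker (boundary K V) : Submodule K (Finset V → K)) :=
    Submodule.finrank_mono (inf_le_inf_right _
      (supportedOn_mono fun s hs => ⟨Finset.subset_univ s, hs.1⟩))
  have h₆ : finrank K (P.map (boundary K V)) ≤ finrank K ((supportedOn K
      (cliquesBelow G (Fintype.card V + 1 + 1))).map (boundary K V)) :=
    Submodule.finrank_mono (Submodule.map_mono (supportedOn_mono fun s hs =>
      ⟨hs.2, by have := s.card_le_univ; omega⟩))
  unfold inducedBetti homologyDim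
  rw [← hP]
  omega

theorem totalBetti_le_exp (hG : ¬ (SimpleGraph.cycleGraph 4).IsIndContained G) :
    (totalBetti K G : ℝ) ≤ Real.exp (Real.exp 100 +
      812 * (Real.log (Fintype.card V) * √(Real.log (Fintype.card V)))) := by
  classical
  have h₁ : (totalBetti K G : ℝ) ≤ inducedBetti K G Finset.univ := by
    exact_mod_cast totalBetti_le_inducedBetti K G
  exact h₁.trans ((noInducedSquare_of_not_isIndContained hG).inducedBetti_le_exp K _ _ rfl)

theorem bMax_lt_rpow {n : ℕ} (hn : 2 ≤ n) :
    (bMax K (SimpleGraph.cycleGraph 4) n : ℝ) <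
      (n : ℝ) ^ ((813 + 2 * Real.exp 100) * √(Real.log n)) := by
  classical
  have hn' : (2 : ℝ) ≤ n := by exact_mod_cast hn
  set x := Real.log n with hx
  have hx0 : 0.69 ≤ x := by
    have := Real.log_le_log (by norm_num) hn'
    linarith [Real.log_two_gt_d9]
  have hs : 0.8 ≤ √x := by
    rw [Real.le_sqrt' (by norm_num)]
    linarith
  -- This lets the summand 2 exp 100 of the exponent's constant absorb the additive exp 100.
  have hxs : 0.5 < x * √x := by nlinarith
  have hle : (bMax K (SimpleGraph.cycleGraph 4) n : ℝ) ≤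
      Real.exp (Real.exp 100 + 812 * (x * √x)) := by
    rw [← Nat.le_floor_iff (Real.exp_pos _).le]
    refine Finset.sup_le fun m hm => Finset.sup_le fun H hH => ?_
    rw [Nat.le_floor_iff (Real.exp_pos _).le]
    refine (totalBetti_le_exp K H (Finset.mem_filter.1 hH).2).trans (Real.exp_le_exp.2 ?_)
    rw [Fintype.card_fin]
    have hmn : m ≤ n := by
      have := Finset.mem_range.1 hm
      omega
    have hlog : Real.log m ≤ x := by
      rcases Nat.eq_zero_or_pos m with rfl | h0
      · simp only [Nat.cast_zero, Real.log_zero]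
        linarith
      · exact Real.log_le_log (by exact_mod_cast h0) (by exact_mod_cast hmn)
    have := mul_le_mul hlog (Real.sqrt_le_sqrt hlog) (Real.sqrt_nonneg _) (by linarith)
    linarith
  refine hle.trans_lt ?_
  rw [Real.rpow_def_of_pos (by linarith), ← hx]
  refine Real.exp_lt_exp.2 ?_
  nlinarith [Real.exp_pos 100]

end UpperBound

/-! ### Lower bound from affine planes -/

section LowerBound

variable (K : Type*) [Field K]

theorem totalBetti_le_bMax {W : Type*} {H : SimpleGraph W} {m n : ℕ} (hmn : m ≤ n)
    {G : SimpleGraph (Fin m)} (hG : ¬ H.IsIndContained G) : totalBetti K G ≤ bMax K H n := by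
  classical
  refine le_trans ?_ (Finset.le_sup (f := fun m =>
    ((Finset.univ : Finset (SimpleGraph (Fin m))).filter fun G => ¬ H.IsIndContained G).sup
      fun G => totalBetti K G) (Finset.mem_range.2 (Nat.lt_succ_of_le hmn)))
  exact Finset.le_sup (f := fun G => totalBetti K G)
    (Finset.mem_filter.2 ⟨Finset.mem_univ G, hG⟩)

theorem finrank_chains {V : Type*} [Fintype V] (G : SimpleGraph V) (k : ℕ) :
    finrank K (chains K G k) = {s : Finset V | G.IsNClique k s}.ncard :=
  finrank_supportedOn {s : Finset V | G.IsNClique k s}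

variable {V : Type*} [LinearOrder V] [Fintype V] (G : SimpleGraph V)

theorem finrank_boundaries_le_chains (k : ℕ) :
    finrank K (boundaries K G k) ≤ finrank K (chains K G k) :=
  Submodule.finrank_mono ((boundaries_le_cycles K G k).trans inf_le_left)

theorem finrank_boundaries_le_chains_succ (k : ℕ) :
    finrank K (boundaries K G k) ≤ finrank K (chains K G (k + 1)) :=
  Submodule.finrank_map_le _ _

theorem finrank_boundaries_add_finrank_cycles_succ (k : ℕ) :
    finrank K (boundaries K G k) + finrank K (cycles K G (k + 1)) =
      finrank K (chains K G (k + 1)) :=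
  finrank_map_add_finrank_inf_ker (boundary K V) (chains K G (k + 1))

theorem finrank_reducedHomology_le_totalBetti {k : ℕ} (hk : k ≤ Fintype.card V) :
    finrank K (ReducedHomology K G k) ≤ totalBetti K G :=
  Finset.single_le_sum (f := fun k => finrank K (ReducedHomology K G k)) (fun _ _ => Nat.zero_le _)
    (Finset.mem_range.2 (Nat.lt_succ_of_le hk))

/-- A triangle-free graph with `v` vertices and `e` edges has total Betti number at least
`e - v`. -/
theorem ncard_edges_le_totalBetti_add (hG : G.CliqueFree 3) (hV : 2 ≤ Fintype.card V) :
    {s : Finset V | G.IsNClique 2 s}.ncard ≤ totalBetti K G + Fintype.card V := by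
  -- Index 2 is degree 1: the cycle space has dimension at least edges minus vertices, and without
  -- triangles there are no boundaries.
  have h₁ := finrank_reducedHomology_le_totalBetti K G hV
  have h₂ := finrank_reducedHomology_add K G 2
  have h₃ : _ + finrank K (cycles K G 2) = finrank K (chains K G 2) :=
    finrank_boundaries_add_finrank_cycles_succ K G 1
  have h₄ := finrank_boundaries_le_chains K G 1
  have h₅ := finrank_boundaries_le_chains_succ K G 2
  rw [finrank_chains] at h₃ h₄ h₅
  have h₆ : {s : Finset V | G.IsNClique (2 + 1) s} = ∅ :=
    Set.eq_empty_of_forall_notMem fun s hs => hG s hs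
  have h₇ : {s : Finset V | G.IsNClique 1 s}.ncard ≤ Fintype.card V := by
    have : {s : Finset V | G.IsNClique 1 s} ⊆ Set.range fun v : V => ({v} : Finset V) := by
      intro s hs
      obtain ⟨a, rfl⟩ := SimpleGraph.isNClique_one.1 hs
      exact ⟨a, rfl⟩
    refine (Set.ncard_le_ncard this (Set.toFinite _)).trans ?_
    rw [← Set.image_univ]
    refine (Set.ncard_image_le (Set.toFinite _)).trans ?_
    rw [Set.ncard_univ, Nat.card_eq_fintype_card]
  rw [h₆, Set.ncard_empty] at h₅
  omega

/-- The graph on no vertices has the single face ∅, which spans a one-dimensional homology in degree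
−1. This settles small n, including n = 0. -/
theorem one_le_bMax {W : Type*} [Nonempty W] (H : SimpleGraph W) (n : ℕ) : 1 ≤ bMax K H n := by
  have hG : ¬ H.IsIndContained (⊥ : SimpleGraph (Fin 0)) := by
    rintro ⟨f⟩
    exact (f (Classical.arbitrary W)).elim0
  refine le_trans ?_ (totalBetti_le_bMax K (Nat.zero_le n) hG)
  refine le_trans ?_ (finrank_reducedHomology_le_totalBetti K _ (Nat.zero_le _))
  have h₁ := finrank_reducedHomology_add K (⊥ : SimpleGraph (Fin 0)) 0
  have h₂ := finrank_boundaries_le_chains_succ K (⊥ : SimpleGraph (Fin 0)) 0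
  have h₃ : {s : Finset (Fin 0) | (⊥ : SimpleGraph (Fin 0)).IsNClique (0 + 1) s} = ∅ :=
    Set.eq_empty_of_forall_notMem fun s hs => by
      obtain ⟨a, -⟩ := SimpleGraph.isNClique_one.1 hs
      exact a.elim0
  rw [finrank_chains, h₃, Set.ncard_empty] at h₂
  have h₄ : chains K (⊥ : SimpleGraph (Fin 0)) 0 ≤ cycles K (⊥ : SimpleGraph (Fin 0)) 0 := by
    refine fun f hf => ⟨hf, LinearMap.mem_ker.2 (funext fun t => ?_)⟩
    exact Finset.sum_eq_zero fun v _ => v.elim0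
  have h₅ := Submodule.finrank_mono h₄
  rw [finrank_chains] at h₅
  have h₆ : {s : Finset (Fin 0) | (⊥ : SimpleGraph (Fin 0)).IsNClique 0 s} = {∅} := by
    ext s
    simp [SimpleGraph.isNClique_zero]
  rw [h₆, Set.ncard_singleton] at h₅
  omega

/-- The incidence graph between the points `(x, y)` and the non-vertical lines `y = a x + b`,
encoded as `(a, b)`, of the affine plane over `F`. -/
def affineIncidence (F : Type*) [Field F] : SimpleGraph ((F × F) ⊕ (F × F)) where
  Adj
    | .inl p, .inr l => p.2 = l.1 * p.1 + l.2
    | .inr l, .inl p => p.2 = l.1 * p.1 + l.2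
    | _, _ => False
  symm := ⟨by rintro (p | l) (p' | l') h <;> exact h⟩
  loopless := ⟨by rintro (p | l) h <;> exact h⟩

variable {F : Type*} [Field F]

theorem affineIncidence_cliqueFree : (affineIncidence F).CliqueFree 3 := by
  classical
  intro s hs
  obtain ⟨a, b, c, hab, hac, hbc, -⟩ := SimpleGraph.is3Clique_iff.1 hs
  rcases a with a | a <;> rcases b with b | b <;> rcases c with c | c <;>
    first | exact hab | exact hac | exact hbc

/-- Two distinct points lie on at most one common line; this is what excludes 4-cycles in the
incidence graph. -/
theorem eq_or_eq_of_incident {p p' l l' : F × F} (h₁ : p.2 = l.1 * p.1 + l.2)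
    (h₂ : p'.2 = l.1 * p'.1 + l.2) (h₃ : p'.2 = l'.1 * p'.1 + l'.2)
    (h₄ : p.2 = l'.1 * p.1 + l'.2) : p = p' ∨ l = l' := by
  have h : (l.1 - l'.1) * (p.1 - p'.1) = 0 := by linear_combination h₄ - h₁ + h₂ - h₃
  rcases mul_eq_zero.1 h with h | h
  · right
    have e := sub_eq_zero.1 h
    refine Prod.ext e ?_
    rw [e] at h₁
    linear_combination h₄ - h₁
  · left
    have e := sub_eq_zero.1 h
    refine Prod.ext e ?_
    rw [h₁, h₂, e]

theorem affineIncidence_no_square {a b c d : (F × F) ⊕ (F × F)}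
    (hab : (affineIncidence F).Adj a b) (hbc : (affineIncidence F).Adj b c)
    (hcd : (affineIncidence F).Adj c d) (hda : (affineIncidence F).Adj d a) : a = c ∨ b = d := by
  rcases a with a | a <;> rcases b with b | b
  · exact hab.elim
  · rcases c with c | c
    · rcases d with d | d
      · exact hcd.elim
      · exact (eq_or_eq_of_incident hab hbc hcd hda).imp (congrArg _) (congrArg _)
    · exact hbc.elim
  · rcases c with c | c
    · exact hbc.elim
    · rcases d with d | d
      · exact (eq_or_eq_of_incident hab hda hcd hbc).symm.imp (congrArg _) (congrArg _)
      · exact hcd.elim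
  · exact hab.elim

theorem card_pow_three_le_ncard_edges [Fintype F] {m : ℕ} (e : Fin m ≃ (F × F) ⊕ (F × F)) :
    Fintype.card F ^ 3 ≤
      {s : Finset (Fin m) | ((affineIncidence F).comap e).IsNClique 2 s}.ncard := by
  -- An edge is determined by a line (a, b) and the abscissa x of a point on it, whence |F|³ edges.
  let f : F × F × F → Finset (Fin m) := fun t =>
    {e.symm (.inl (t.1, t.2.1 * t.1 + t.2.2)), e.symm (.inr t.2)}
  have hf : Function.Injective f := by
    intro t t' h
    have h₁ : e.symm (.inl (t.1, t.2.1 * t.1 + t.2.2)) ∈ f t' := h ▸ by simp [f]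
    have h₂ : e.symm (.inr t.2) ∈ f t' := h ▸ by simp [f]
    simp only [f, Finset.mem_insert, Finset.mem_singleton, EmbeddingLike.apply_eq_iff_eq,
      Sum.inl.injEq, Sum.inr.injEq, Prod.mk.injEq, reduceCtorEq, or_false, false_or] at h₁ h₂
    exact Prod.ext h₁.1 h₂
  have hsub : Set.range f ⊆ {s : Finset (Fin m) | ((affineIncidence F).comap e).IsNClique 2 s} := by
    rintro _ ⟨t, rfl⟩
    refine ⟨?_, ?_⟩
    · simp only [f, Finset.coe_insert, Finset.coe_singleton, SimpleGraph.isClique_pair]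
      intro _
      change (affineIncidence F).Adj (e _) (e _)
      rw [e.apply_symm_apply, e.apply_symm_apply]
      rfl
    · exact Finset.card_pair (by simp)
  refine le_trans ?_ (Set.ncard_le_ncard hsub (Set.toFinite _))
  rw [← Set.image_univ, Set.ncard_image_of_injective _ hf, Set.ncard_univ,
    Nat.card_eq_fintype_card, Fintype.card_prod, Fintype.card_prod]
  exact le_of_eq (by ring)

theorem prime_pow_three_le_bMax_add {p n : ℕ} (hp : p.Prime) (hn : 2 * p ^ 2 ≤ n) :
    p ^ 3 ≤ bMax K (SimpleGraph.cycleGraph 4) n + 2 * p ^ 2 := by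
  have := Fact.mk hp
  have hcard : Fintype.card ((ZMod p × ZMod p) ⊕ (ZMod p × ZMod p)) = 2 * p ^ 2 := by
    rw [Fintype.card_sum, Fintype.card_prod, ZMod.card]
    ring
  let e : Fin (2 * p ^ 2) ≃ (ZMod p × ZMod p) ⊕ (ZMod p × ZMod p) :=
    (Fintype.equivFinOfCardEq hcard).symm
  have h₁ := card_pow_three_le_ncard_edges e
  have h₂ := ncard_edges_le_totalBetti_add K ((affineIncidence (ZMod p)).comap e)
    (affineIncidence_cliqueFree.comap
      ⟨(SimpleGraph.Embedding.comap e.toEmbedding (affineIncidence (ZMod p))).toCopy⟩) (by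
      rw [Fintype.card_fin]
      have : 1 ≤ p ^ 2 := Nat.one_le_pow _ _ hp.pos
      omega)
  have h₃ : ¬ (SimpleGraph.cycleGraph 4).IsIndContained ((affineIncidence (ZMod p)).comap e) := by
    rintro ⟨f⟩
    have hadj : ∀ i j : Fin 4, (SimpleGraph.cycleGraph 4).Adj i j →
        (affineIncidence (ZMod p)).Adj (e (f i)) (e (f j)) := fun i j h => f.map_rel_iff.2 h
    rcases affineIncidence_no_square (hadj 0 1 (by decide)) (hadj 1 2 (by decide))
      (hadj 2 3 (by decide)) (hadj 3 0 (by decide)) with h | h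
    · exact absurd (f.injective (e.injective h)) (by decide)
    · exact absurd (f.injective (e.injective h)) (by decide)
  have h₄ := totalBetti_le_bMax K hn h₃
  rw [ZMod.card] at h₁
  rw [Fintype.card_fin] at h₂
  omega

theorem mul_rpow_lt_bMax (n : ℕ) :
    1 / 200 * (n : ℝ) ^ (3 / 2 : ℝ) < bMax K (SimpleGraph.cycleGraph 4) n := by
  have hpow : ∀ y : ℝ, 0 ≤ y → (y ^ 2) ^ (3 / 2 : ℝ) = y ^ 3 := fun y hy => by
    rw [← Real.rpow_natCast, ← Real.rpow_mul hy, ← Real.rpow_natCast]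
    norm_num
  rcases Nat.lt_or_ge n 32 with h | h
  · have h₁ : (1 : ℝ) ≤ bMax K (SimpleGraph.cycleGraph 4) n := by
      exact_mod_cast one_le_bMax K (SimpleGraph.cycleGraph 4) n
    -- Here 31 < 5.7² and 5.7³ < 200, which is where the constant 1/200 comes from.
    have h₂ : (n : ℝ) ^ (3 / 2 : ℝ) ≤ (5.7 ^ 2) ^ (3 / 2 : ℝ) := by
      refine Real.rpow_le_rpow (Nat.cast_nonneg n) ?_ (by norm_num)
      have : (n : ℝ) ≤ 31 := by exact_mod_cast Nat.le_of_lt_succ h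
      linarith
    rw [hpow _ (by norm_num)] at h₂
    linarith
  · set k := Nat.sqrt (n / 8) with hk
    have hk2 : 2 ≤ k := Nat.le_sqrt.2 (by omega)
    obtain ⟨p, hp, hkp, hpk⟩ := Nat.exists_prime_lt_and_le_two_mul k (by omega)
    have hkn : k * k ≤ n / 8 := Nat.sqrt_le _
    have hnk : n / 8 < (k + 1) * (k + 1) := Nat.lt_succ_sqrt _
    have hpn : 2 * p ^ 2 ≤ n := by
      have : p ^ 2 ≤ (2 * k) ^ 2 := Nat.pow_le_pow_left hpk 2
      have : (2 * k) ^ 2 = 4 * (k * k) := by ring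
      omega
    have hnp : n ≤ 8 * p ^ 2 := by
      have : (k + 1) * (k + 1) ≤ p * p := Nat.mul_le_mul hkp hkp
      rw [sq]
      omega
    have h₁ : (p : ℝ) ^ 3 ≤ bMax K (SimpleGraph.cycleGraph 4) n + 2 * (p : ℝ) ^ 2 := by
      exact_mod_cast prime_pow_three_le_bMax_add K hp hpn
    have hp3 : (3 : ℝ) ≤ p := by exact_mod_cast (show 3 ≤ p by omega)
    have h₂ : (n : ℝ) ^ (3 / 2 : ℝ) ≤ ((3 * p) ^ 2) ^ (3 / 2 : ℝ) := by
      refine Real.rpow_le_rpow (Nat.cast_nonneg n) ?_ (by norm_num)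
      have : (n : ℝ) ≤ 8 * (p : ℝ) ^ 2 := by exact_mod_cast hnp
      nlinarith
    rw [hpow _ (by positivity)] at h₂
    have h₃ : (0 : ℝ) < (p : ℝ) ^ 3 := by positivity
    have h₄ : 2 * (p : ℝ) ^ 2 ≤ 2 / 3 * (p : ℝ) ^ 3 := by nlinarith [sq_nonneg (p : ℝ)]
    have h₅ : (3 * (p : ℝ)) ^ 3 = 27 * (p : ℝ) ^ 3 := by ring
    rw [h₅] at h₂
    linarith

end LowerBound

end CliqueBetti

theorem mainTheorem3 :
    ∃ c C : ℝ, 0 < c ∧ 0 < C ∧ ∀ (K : Type*) [Field K] (n : ℕ),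
      c * (n : ℝ) ^ (3 / 2 : ℝ) < (CliqueBetti.bMax K (SimpleGraph.cycleGraph 4) n : ℝ) ∧
      (2 ≤ n → (CliqueBetti.bMax K (SimpleGraph.cycleGraph 4) n : ℝ) <
        (n : ℝ) ^ (C * Real.sqrt (Real.log n))) :=
  ⟨1 / 200, 813 + 2 * Real.exp 100, by norm_num, by positivity, fun K _ n =>
    ⟨CliqueBetti.mul_rpow_lt_bMax K n, fun hn => CliqueBetti.bMax_lt_rpow K hn⟩⟩
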